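/- Assume the Riemann hypothesis and that all but finitely many of the zeros of the Riemann zeta function are simple. For a real number $M\ge 1$ and a real sequence $(x_n)_{n\le M}$ put $A(s)=\sum_{n\le M}x_n n^{-s}$, $\|x_n\|_\infty=\max_{n\le M}|x_n|$ and $\|x_n\|_1=\sum_{n\le M}|x_n|$ (and likewise $\|\tfrac{x_n}{n}\|_1=\sum_{n\le M}|x_n|/n$, $\|x_n^2\|_1=\sum_{n\le M}x_n^2$). Let $T_1=T+O(1)$ and $T_2=2T+O(1)$ be such that, for $j=1,2$, uniformly for $-1\le\sigma\le 2$ one has $\zeta(\sigma+iT_j)\ne 0$ and $\zeta(\sigma+iT_j)^{-1}\ll_\delta T_j^{\delta}$ for every $\delta>0$, and suppose that $\|\tfrac{x_n}{n}\|_1\ll_\delta T^{\delta}$ for every $\delta>0$. Then for every $\varepsilon>0$ and all sufficiently large $T$ \[ S_3:=\sum_{T_1<\gamma<T_2}\zeta'(\rho)^{-1}|A(\rho)|^2=\frac{T_2-T_1}{2\pi}\sum_{hn\le M}\frac{\mu(n)x_hx_{nh}}{nh}+O\Bigl(T^{\varepsilon}\bigl(M\|x_n\|_\infty+\|x_n\|_1+T^{1/2}\|x_n^2\|_1^{1/2}\bigr)\Bigr),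 \] where the first sum runs over the nontrivial zeros $\rho=\beta+i\gamma$ of $\zeta$ with $T_1<\gamma<T_2$, the second over positive integers $h,n$ with $hn\le M$, and $\mu$ is the Möbius function. The implied constant and the meaning of "sufficiently large" depend only on $\varepsilon$ and on the implied constants in the hypotheses (the bounds for $|T_1-T|$ and $|T_2-2T|$, and the constants in the bounds $\ll_\delta$). -/

import Mathlib

open scoped NNReal

noncomputable section

/-- The set of nontrivial zeros `ρ = β + iγ` of the Riemann zeta function with `T₁ < γ < T₂`. -/
def zetaZerosBetween (T₁ T₂ : ℝ) : Set ℂ :=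
  {ρ | riemannZeta ρ = 0 ∧ (0 < ρ.re ∧ ρ.re < 1) ∧ (T₁ < ρ.im ∧ ρ.im < T₂)}

theorem zetaZerosBetween_finite (T₁ T₂ : ℝ) : (zetaZerosBetween T₁ T₂).Finite := by
  have hc : IsCompact (Set.Icc (0 : ℝ) 1 ×ℂ Set.Icc T₁ T₂) := isCompact_Icc.reProdIm isCompact_Icc
  refine hc.inter_riemannZetaZeros_finite.subset ?_
  rintro ρ ⟨h0, ⟨h1, h2⟩, h3, h4⟩
  exact ⟨⟨⟨h1.le, h2.le⟩, h3.le, h4.le⟩, h0⟩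

/-- The Dirichlet polynomial `A(s) = ∑_{n ≤ M} xₙ n^{-s}`. -/
def dirichletPoly (x : ℕ → ℝ) (M : ℝ) (s : ℂ) : ℂ :=
  ∑ n ∈ Finset.Icc 1 ⌊M⌋₊, (x n : ℂ) * (n : ℂ) ^ (-s)

/-- `‖xₙ‖₁ = ∑_{n ≤ M} |xₙ|`. -/
def seqNormOne (x : ℕ → ℝ) (M : ℝ) : ℝ :=
  ∑ n ∈ Finset.Icc 1 ⌊M⌋₊, |x n|

/-- `‖xₙ‖_∞ = max_{n ≤ M} |xₙ|`. -/
def seqNormSup (x : ℕ → ℝ) (M : ℝ) : ℝ :=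
  ((Finset.Icc 1 ⌊M⌋₊).sup fun n => ‖x n‖₊ : ℝ≥0)

/-- The sum `∑_{T₁ < γ < T₂} ζ'(ρ)⁻¹ |A(ρ)|²` over the nontrivial zeros. -/
def zetaZeroMoment (x : ℕ → ℝ) (M T₁ T₂ : ℝ) : ℂ :=
  ∑ ρ ∈ (zetaZerosBetween_finite T₁ T₂).toFinset,
    (deriv riemannZeta ρ)⁻¹ * ((‖dirichletPoly x M ρ‖ ^ 2 : ℝ) : ℂ)

/-- The sum `∑_{hn ≤ M} μ(n) x_h x_{nh} / (nh)` over positive integers `h`, `n`. -/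
def moebiusQuadraticForm (x : ℕ → ℝ) (M : ℝ) : ℝ :=
  ∑ p ∈ Finset.Icc 1 ⌊M⌋₊ ×ˢ Finset.Icc 1 ⌊M⌋₊ with ((p.1 * p.2 : ℕ) : ℝ) ≤ M,
    (ArithmeticFunction.moebius p.2 : ℝ) * x p.1 * x (p.2 * p.1) / ((p.2 * p.1 : ℕ) : ℝ)

/-- `t` is a height at which `ζ(σ + it)⁻¹ ≪ t^δ` for every `δ > 0`, uniformly for
`-1 ≤ σ ≤ 2`, with implied constants `K δ`. -/
def IsGoodHeight (K : ℝ → ℝ) (t : ℝ) : Prop :=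
  ∀ σ : ℝ, -1 ≤ σ → σ ≤ 2 →
    riemannZeta (σ + t * Complex.I) ≠ 0 ∧
      ∀ δ : ℝ, 0 < δ → ‖(riemannZeta (σ + t * Complex.I))⁻¹‖ ≤ K δ * t ^ δ

end

open Complex Set MeasureTheory intervalIntegral Filter
open scoped Interval Topology

/-! Under the Riemann hypothesis every zero has `conj ρ = 1 - ρ`, so `|A(ρ)|²` is the restriction to
the zeros of the entire function `∑ (x_k / k) x_h (k/h)^s`. The moment is thus a combination of the
sums `∑ r^ρ / ζ'(ρ)` with `r = k/h`, and for simple zeros these are residues of `r^s / ζ(s)`. They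
are computed on the rectangle with vertical sides `σ = -δ` and `σ = 1 + δ`; the horizontal sides are
small because the heights are good.

On the right side `1/ζ = ∑ μ(n) n^{-s}`. The term `nh = k` does not oscillate and gives `(T₂ - T₁)
μ(k/h)`, which produces the main term. The other terms oscillate with frequency `log(k/(nh))`, and
their total over `h`, `k` is controlled by `‖x_n‖₁` and `M ‖x_n‖_∞` times `‖x_n/n‖₁`
(`norm_verticalIntegral_sub_le`, `sum_offDiagonalSum_div_le`).

On the left side the functional equation gives `1/ζ ≪ t^{-1/2}`. The sum over `h` is kept inside the
integral, and Cauchy–Schwarz with a mean value theorem yields `((T + M) ‖x_n²‖₁)^{1/2}`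
(`exists_norm_sum_verticalIntegral_le`).

Since `M` is not bounded by a power of `T`, the losses `(k/h)^{±δ}` are harmless only when `k/h`
lies between `T^{-48}` and `T^{48}`. For the remaining pairs the rectangle `1/4 ≤ σ ≤ 3/4` is used:
there RH gives a polynomial bound for `1/ζ` through Borel–Carathéodory, and the extreme size of
`k/h` absorbs it (`exists_norm_zetaZeroSum_le`). -/

/-! ### The residue theorem on a rectangle. -/

/-- The integral of `g` along the positively oriented boundary of `[a, b] × [c, d]`. -/
noncomputable def rectBoundaryIntegral (g : ℂ → ℂ) (a b c d : ℝ) : ℂ :=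
  (∫ x in a..b, g (x + c * I)) - (∫ x in a..b, g (x + d * I)) +
    I * (∫ y in c..d, g (b + y * I)) - I * (∫ y in c..d, g (a + y * I))

/-- A quarter turn clockwise from the open first quadrant does not cross the branch cut. This is the
jump between the logarithm branches of two adjacent sides. -/
theorem log_sub_log_neg_I_mul {w : ℂ} (h1 : 0 < w.re) (h2 : 0 < w.im) :
    log w - log (-I * w) = Real.pi / 2 * I := by
  have hw : w ≠ 0 := by rintro rfl; simp at h1
  have ha := (Complex.abs_arg_lt_pi_div_two_iff.2 (Or.inl h1))
  have ha2 : 0 ≤ arg w := Complex.arg_nonneg_iff.2 h2.le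
  rw [abs_lt] at ha
  rw [Complex.log_mul (by simp) hw, Complex.log_neg_I]
  · ring
  · rw [Complex.arg_neg_I]
    constructor <;> linarith [Real.pi_pos]

/-- On each side `log (u * (s - ρ))` is a primitive, where `u ∈ {I, 1, -I, -1}` rotates that side
into the right half plane. The four corner jumps of `π/2 * I` add up to `2πi`. -/
theorem rectBoundaryIntegral_inv_sub {a b c d : ℝ} {ρ : ℂ} (ha : a < ρ.re) (hb : ρ.re < b)
    (hc : c < ρ.im) (hd : ρ.im < d) :
    rectBoundaryIntegral (fun s => (s - ρ)⁻¹) a b c d = 2 * Real.pi * I := by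
  have key : ∀ (u p v : ℂ) (s t : ℝ), (∀ x : ℝ, u * (p + x * v - ρ) ∈ slitPlane) →
      v * ∫ x in s..t, (p + x * v - ρ)⁻¹ = log (u * (p + t * v - ρ)) - log (u * (p + s * v - ρ)) := by
    intro u p v s t h
    have hne : ∀ x : ℝ, u * (p + x * v - ρ) ≠ 0 := fun x => slitPlane_ne_zero (h x)
    have hu : u ≠ 0 := fun h0 => hne 0 (by simp [h0])
    have hne' : ∀ x : ℝ, (p + x * v - ρ) ≠ 0 := fun x h0 => hne x (by simp [h0])
    rw [← intervalIntegral.integral_const_mul]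
    rw [integral_eq_sub_of_hasDerivAt (f := fun x : ℝ => log (u * (p + x * v - ρ)))]
    · intro x _
      have h1 : HasDerivAt (fun x : ℝ => u * (p + x * v - ρ)) (u * (1 * v)) x := by
        exact ((((Complex.ofRealCLM.hasDerivAt (x := x)).mul_const v).const_add p).sub_const ρ).const_mul u
      have h2 := h1.clog_real (h x)
      rw [one_mul, mul_div_mul_left _ _ hu, div_eq_mul_inv] at h2
      exact h2
    · apply Continuous.intervalIntegrable
      refine continuous_const.mul (Continuous.inv₀ (by fun_prop) hne')
  have e1 := key I (c * I) 1 a b (fun x => Or.inl (by simp; linarith))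
  have e2 := key (-I) (d * I) 1 a b (fun x => Or.inl (by simp; linarith))
  have e3 := key 1 b I c d (fun x => Or.inl (by simp; linarith))
  have e4 := key (-1) a I c d (fun x => Or.inl (by simp; linarith))
  have f1 := log_sub_log_neg_I_mul (w := I * (c * I + b * 1 - ρ)) (by simp; linarith) (by simp; linarith)
  have f2 := log_sub_log_neg_I_mul (w := 1 * (b + d * I - ρ)) (by simp; linarith) (by simp; linarith)
  have f3 := log_sub_log_neg_I_mul (w := -I * (d * I + a * 1 - ρ)) (by simp; linarith) (by simp; linarith)
  have f4 := log_sub_log_neg_I_mul (w := -1 * (a + c * I - ρ)) (by simp; linarith) (by simp; linarith)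
  simp only [one_mul, mul_one] at e1 e2
  unfold rectBoundaryIntegral
  have g1 : -I * (I * (c * I + b * 1 - ρ)) = 1 * (b + c * I - ρ) := by
    linear_combination (-(c * I + b * 1 - ρ)) * I_sq
  have g2 : -I * (1 * (b + d * I - ρ)) = -I * (d * I + b - ρ) := by ring
  have g3 : -I * (-I * (d * I + a * 1 - ρ)) = -1 * (a + d * I - ρ) := by
    linear_combination (d * I + a * 1 - ρ) * I_sq
  have g4 : -I * (-1 * (a + c * I - ρ)) = I * (c * I + a - ρ) := by ring
  rw [g1, mul_one] at f1
  rw [g2] at f2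
  rw [g3, mul_one] at f3
  rw [g4] at f4
  have c1 : ∀ e : ℝ, (∫ x in a..b, ((x : ℂ) + e * I - ρ)⁻¹) = ∫ x in a..b, (e * I + (x : ℂ) - ρ)⁻¹ := by
    intro e; simp only [add_comm]
  rw [c1, c1, e1, e2, e3, e4]
  linear_combination f1 + f2 + f3 + f4

/-- Continuity is required on the boundary only, since the functions it is applied to have poles
inside. -/
theorem rectBoundaryIntegral_sub_sum {ι : Type*} {Z : Finset ι} {g : ℂ → ℂ} {f : ι → ℂ → ℂ}
    {a b c d : ℝ} (hab : a ≤ b) (hcd : c ≤ d)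
    (hg : ContinuousOn g ((Icc a b ×ℂ Icc c d) \ (Ioo a b ×ℂ Ioo c d)))
    (hf : ∀ i ∈ Z, ContinuousOn (f i) ((Icc a b ×ℂ Icc c d) \ (Ioo a b ×ℂ Ioo c d))) :
    rectBoundaryIntegral (fun s => g s - ∑ i ∈ Z, f i s) a b c d =
      rectBoundaryIntegral g a b c d - ∑ i ∈ Z, rectBoundaryIntegral (f i) a b c d := by
  have hor : ∀ h : ℂ → ℂ, ContinuousOn h ((Icc a b ×ℂ Icc c d) \ (Ioo a b ×ℂ Ioo c d)) →
      ∀ e, e = c ∨ e = d → IntervalIntegrable (fun x : ℝ => h (x + e * I)) volume a b := by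
    intro h hh e he
    apply ContinuousOn.intervalIntegrable
    refine hh.comp (by fun_prop) ?_
    intro x hx
    rw [uIcc_of_le hab] at hx
    refine ⟨⟨by simpa using hx, ?_⟩, fun h' => ?_⟩
    · rcases he with rfl | rfl <;> simp [hcd]
    · have := h'.2
      rcases he with rfl | rfl <;> simp at this
  have ver : ∀ h : ℂ → ℂ, ContinuousOn h ((Icc a b ×ℂ Icc c d) \ (Ioo a b ×ℂ Ioo c d)) →
      ∀ e, e = a ∨ e = b → IntervalIntegrable (fun y : ℝ => h (e + y * I)) volume c d := by
    intro h hh e he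
    apply ContinuousOn.intervalIntegrable
    refine hh.comp (by fun_prop) ?_
    intro x hx
    rw [uIcc_of_le hcd] at hx
    refine ⟨⟨?_, by simpa using hx⟩, fun h' => ?_⟩
    · rcases he with rfl | rfl <;> simp [hab]
    · have := h'.1
      rcases he with rfl | rfl <;> simp at this
  have hs : ContinuousOn (fun s => ∑ i ∈ Z, f i s) ((Icc a b ×ℂ Icc c d) \ (Ioo a b ×ℂ Ioo c d)) :=
    continuousOn_finsetSum _ hf
  unfold rectBoundaryIntegral
  beta_reduce
  rw [integral_sub (hor _ hg _ (Or.inl rfl)) (hor _ hs _ (Or.inl rfl)),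
    integral_sub (hor _ hg _ (Or.inr rfl)) (hor _ hs _ (Or.inr rfl)),
    integral_sub (ver _ hg _ (Or.inl rfl)) (ver _ hs _ (Or.inl rfl)),
    integral_sub (ver _ hg _ (Or.inr rfl)) (ver _ hs _ (Or.inr rfl)),
    integral_finsetSum fun i hi => hor _ (hf i hi) _ (Or.inl rfl),
    integral_finsetSum fun i hi => hor _ (hf i hi) _ (Or.inr rfl),
    integral_finsetSum fun i hi => ver _ (hf i hi) _ (Or.inl rfl),
    integral_finsetSum fun i hi => ver _ (hf i hi) _ (Or.inr rfl)]
  simp only [Finset.sum_add_distrib, Finset.sum_sub_distrib, Finset.mul_sum, mul_sub]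
  ring

/-- Residue theorem on a rectangle for a quotient with simple poles. -/
theorem rectBoundaryIntegral_div {f F : ℂ → ℂ} {a b c d : ℝ} (hab : a ≤ b) (hcd : c ≤ d)
    (hf : ∀ s ∈ Icc a b ×ℂ Icc c d, AnalyticAt ℂ f s)
    (hF : ∀ s ∈ Icc a b ×ℂ Icc c d, AnalyticAt ℂ F s)
    (Z : Finset ℂ) (hZ : ∀ s ∈ Z, s ∈ Ioo a b ×ℂ Ioo c d)
    (hZf : ∀ s ∈ Icc a b ×ℂ Icc c d, f s = 0 ↔ s ∈ Z)
    (hZd : ∀ s ∈ Z, deriv f s ≠ 0) :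
    rectBoundaryIntegral (fun s => F s / f s) a b c d =
      2 * Real.pi * I * ∑ ρ ∈ Z, (deriv f ρ)⁻¹ * F ρ := by
  classical
  have hZc : ∀ s ∈ Z, s ∈ Icc a b ×ℂ Icc c d := fun s hs =>
    ⟨Ioo_subset_Icc_self (hZ s hs).1, Ioo_subset_Icc_self (hZ s hs).2⟩
  set h : ℂ → ℂ := fun s => F s / f s - ∑ ρ ∈ Z, (deriv f ρ)⁻¹ * F ρ * (s - ρ)⁻¹ with hh
  -- Near `ρ` write `f = (s - ρ) u` with `u = dslope f ρ`. Then `F / f` minus its polar part at `ρ`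
  -- is the difference quotient of `F / u`, which is analytic.
  have hreg : ∀ ρ ∈ Z, ∃ g : ℂ → ℂ, AnalyticAt ℂ g ρ ∧ ∀ᶠ s in 𝓝[≠] ρ, h s = g s := by
    intro ρ hρ
    have hfρ := hf ρ (hZc ρ hρ)
    have hFρ := hF ρ (hZc ρ hρ)
    have h0 : f ρ = 0 := (hZf ρ (hZc ρ hρ)).2 hρ
    have hu : AnalyticAt ℂ (dslope f ρ) ρ := by
      obtain ⟨p, hp⟩ := hfρ
      exact ⟨_, hp.has_fpower_series_dslope_fslope⟩
    have hu0 : dslope f ρ ρ ≠ 0 := by rw [dslope_same]; exact hZd ρ hρ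
    have hq : AnalyticAt ℂ (fun s => F s / dslope f ρ s) ρ := hFρ.div hu hu0
    have hq2 : AnalyticAt ℂ (dslope (fun s => F s / dslope f ρ s) ρ) ρ := by
      obtain ⟨p, hp⟩ := hq
      exact ⟨_, hp.has_fpower_series_dslope_fslope⟩
    refine ⟨fun s => dslope (fun s => F s / dslope f ρ s) ρ s -
      ∑ σ ∈ Z.erase ρ, (deriv f σ)⁻¹ * F σ * (s - σ)⁻¹, ?_, ?_⟩
    · refine hq2.sub (Finset.analyticAt_fun_sum _ fun σ hσ => ?_)
      refine analyticAt_const.mul (AnalyticAt.inv (analyticAt_id.sub analyticAt_const) ?_)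
      exact sub_ne_zero.2 (Finset.ne_of_mem_erase hσ).symm
    · filter_upwards [self_mem_nhdsWithin] with s hs
      have hs' : s - ρ ≠ 0 := sub_ne_zero.2 hs
      rw [hh]
      simp only
      rw [← Finset.add_sum_erase Z _ hρ, dslope_of_ne _ hs, slope_def_field, dslope_same,
        dslope_of_ne _ hs, slope_def_field, h0, sub_zero]
      have : F s / (f s / (s - ρ)) = F s / f s * (s - ρ) := by
        rw [div_div_eq_mul_div]; ring
      rw [this]
      field_simp
      ring
  choose! g hg1 hg2 using hreg
  -- Filling in the removable singularities gives a function to which Cauchy's theorem applies;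
  -- nothing changes on the boundary.
  set h' : ℂ → ℂ := fun s => if s ∈ Z then g s s else h s with hh'
  have hnot : ∀ s ∈ Icc a b ×ℂ Icc c d, s ∉ Z → AnalyticAt ℂ h s := by
    intro s hs hsZ
    refine ((hF s hs).div (hf s hs) fun h0 => hsZ ((hZf s hs).1 h0)).sub
      (Finset.analyticAt_fun_sum _ fun σ hσ => ?_)
    refine analyticAt_const.mul (AnalyticAt.inv (analyticAt_id.sub analyticAt_const) ?_)
    exact sub_ne_zero.2 fun e => hsZ (by rw [e]; exact hσ)
  have hcl : IsClosed (Z : Set ℂ) := Z.finite_toSet.isClosed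
  have hdiff : DifferentiableOn ℂ h' (Icc a b ×ℂ Icc c d) := by
    intro s hs
    apply DifferentiableAt.differentiableWithinAt
    by_cases hsZ : s ∈ Z
    · refine (hg1 s hsZ).differentiableAt.congr_of_eventuallyEq ?_
      have h1 : ∀ᶠ z in 𝓝[≠] s, z ∉ Z := by
        have : ∀ᶠ z in 𝓝 s, z ∉ Z.erase s := by
          refine ((Z.erase s).finite_toSet.isClosed.isOpen_compl).mem_nhds ?_
          simp
        filter_upwards [nhdsWithin_le_nhds this, self_mem_nhdsWithin] with z hz hz' hzZ
        exact hz (Finset.mem_erase.2 ⟨hz', hzZ⟩)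
      have h2 : ∀ᶠ z in 𝓝[≠] s, h' z = g s z := by
        filter_upwards [h1, hg2 s hsZ] with z hz1 hz2
        rw [hh']; simp only [hz1, if_false, hz2]
      rw [eventually_nhdsWithin_iff] at h2
      filter_upwards [h2] with z hz
      by_cases hzs : z = s
      · subst hzs; rw [hh']; simp [hsZ]
      · exact hz hzs
    · refine (hnot s hs hsZ).differentiableAt.congr_of_eventuallyEq ?_
      filter_upwards [hcl.isOpen_compl.mem_nhds hsZ] with z hz
      rw [hh']; simp only; rw [if_neg (show z ∉ Z from hz)]
  have hzero : rectBoundaryIntegral h' a b c d = 0 := by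
    have := Complex.integral_boundary_rect_eq_zero_of_differentiableOn h' (a + c * I) (b + d * I)
      (by simpa [uIcc_of_le hab, uIcc_of_le hcd] using hdiff)
    simpa [rectBoundaryIntegral] using this
  have hbd : ∀ s, s ∉ Ioo a b ×ℂ Ioo c d → h' s = h s := by
    intro s hs
    rw [hh']; simp only; rw [if_neg fun hz => hs (hZ s hz)]
  have heq : rectBoundaryIntegral h' a b c d = rectBoundaryIntegral h a b c d := by
    unfold rectBoundaryIntegral
    have k1 : ∀ x : ℝ, h' (x + c * I) = h (x + c * I) := fun x => hbd _ fun q => by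
      have := q.2; simp at this
    have k2 : ∀ x : ℝ, h' (x + d * I) = h (x + d * I) := fun x => hbd _ fun q => by
      have := q.2; simp at this
    have k3 : ∀ x : ℝ, h' (a + x * I) = h (a + x * I) := fun x => hbd _ fun q => by
      have := q.1; simp at this
    have k4 : ∀ x : ℝ, h' (b + x * I) = h (b + x * I) := fun x => hbd _ fun q => by
      have := q.1; simp at this
    simp only [k1, k2, k3, k4]
  rw [heq, hh, rectBoundaryIntegral_sub_sum hab hcd, sub_eq_zero] at hzero
  · rw [hzero, Finset.mul_sum]
    refine Finset.sum_congr rfl fun ρ hρ => ?_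
    have h1 : rectBoundaryIntegral (fun s => (deriv f ρ)⁻¹ * F ρ * (s - ρ)⁻¹) a b c d =
        (deriv f ρ)⁻¹ * F ρ * rectBoundaryIntegral (fun s => (s - ρ)⁻¹) a b c d := by
      unfold rectBoundaryIntegral
      simp only [intervalIntegral.integral_const_mul]
      ring
    rw [h1, rectBoundaryIntegral_inv_sub (hZ ρ hρ).1.1 (hZ ρ hρ).1.2 (hZ ρ hρ).2.1 (hZ ρ hρ).2.2]
    ring
  · intro s hs
    refine (((hF s hs.1).div (hf s hs.1) fun h0 => hs.2 (hZ s ((hZf s hs.1).1 h0)))).continuousAt.continuousWithinAt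
  · intro ρ hρ s hs
    refine ContinuousAt.continuousWithinAt ?_
    refine continuousAt_const.mul (ContinuousAt.inv₀ (by fun_prop) ?_)
    exact sub_ne_zero.2 fun e => hs.2 (by rw [e]; exact hZ ρ hρ)

/-! ### Residues of `F / ζ` under the Riemann hypothesis. -/

theorem re_eq_half_of_riemannZeta_eq_zero (hRH : RiemannHypothesis) {s : ℂ}
    (hs : riemannZeta s = 0) (him : s.im ≠ 0) : s.re = 1 / 2 := by
  refine hRH s hs ?_ ?_
  · rintro ⟨n, rfl⟩
    apply him
    simp [Complex.mul_im]
  · rintro rfl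
    simp at him

/-- Residue theorem for `F / ζ` on a rectangle that meets the critical line, under the
Riemann hypothesis. -/
theorem rectBoundaryIntegral_div_riemannZeta (hRH : RiemannHypothesis) {F : ℂ → ℂ}
    (hF : Differentiable ℂ F) {a b T₁ T₂ : ℝ} (ha : a < 1 / 2) (hb : 1 / 2 < b) (h0 : 0 < T₁)
    (h12 : T₁ ≤ T₂) (hsimple : ∀ s, riemannZeta s = 0 → T₁ ≤ s.im → deriv riemannZeta s ≠ 0)
    (h1 : riemannZeta (1 / 2 + T₁ * I) ≠ 0) (h2 : riemannZeta (1 / 2 + T₂ * I) ≠ 0) :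
    rectBoundaryIntegral (fun s => F s / riemannZeta s) a b T₁ T₂ =
      2 * Real.pi * I * ∑ ρ ∈ (zetaZerosBetween_finite T₁ T₂).toFinset,
        (deriv riemannZeta ρ)⁻¹ * F ρ := by
  -- Any zero in the closed range of heights is on the critical line, and the two points of that
  -- line at heights `T₁`, `T₂` are excluded, so no zero meets the boundary.
  have hmem : ∀ s, s ∈ (zetaZerosBetween_finite T₁ T₂).toFinset ↔
      riemannZeta s = 0 ∧ T₁ ≤ s.im ∧ s.im ≤ T₂ := by
    intro s
    rw [Set.Finite.mem_toFinset]
    constructor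
    · rintro ⟨hz, -, hi1, hi2⟩
      exact ⟨hz, hi1.le, hi2.le⟩
    · rintro ⟨hz, hi1, hi2⟩
      have hre := re_eq_half_of_riemannZeta_eq_zero hRH hz (by linarith)
      have hse : s = 1 / 2 + s.im * I := by
        apply Complex.ext <;> simp [hre]
      refine ⟨hz, by rw [hre]; norm_num, lt_of_le_of_ne hi1 ?_, lt_of_le_of_ne hi2 ?_⟩
      · intro e; apply h1; rw [e, ← hse]; exact hz
      · intro e; apply h2; rw [← e, ← hse]; exact hz
  apply rectBoundaryIntegral_div (ha.le.trans hb.le) h12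
  · intro s hs
    have hs1 : s ∈ ({1}ᶜ : Set ℂ) := by
      rintro rfl
      have := hs.2.1
      simp at this
      linarith
    exact (differentiableOn_riemannZeta.analyticOnNhd isOpen_compl_singleton) s hs1
  · intro s _
    exact hF.analyticAt s
  · intro s hs
    have h := (hmem s).1 hs
    rw [Set.Finite.mem_toFinset] at hs
    have hre := re_eq_half_of_riemannZeta_eq_zero hRH h.1 (by linarith)
    refine ⟨⟨?_, ?_⟩, hs.2.2⟩
    · rw [hre]; exact ha
    · rw [hre]; exact hb
  · intro s hs
    rw [hmem]
    exact ⟨fun h => ⟨h, hs.2.1, hs.2.2⟩, fun h => h.1⟩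
  · intro s hs
    have h := (hmem s).1 hs
    exact hsimple s h.1 h.2.1

/-! ### Growth of `ζ` to the right of the critical line. -/

theorem norm_natCast_cpow_sub_cpow_le {s : ℂ} (hs : 0 ≤ s.re) {n : ℕ} (hn : 0 < n) {x : ℝ}
    (hx : x ∈ Icc (n : ℝ) (n + 1)) :
    ‖(x : ℂ) ^ (-s) - (n : ℂ) ^ (-s)‖ ≤ ‖s‖ * (n : ℝ) ^ (-s.re - 1) := by
  have hn' : (0 : ℝ) < n := by exact_mod_cast hn
  by_cases hs0 : s = 0
  · simp [hs0]
  have := (convex_Icc (n : ℝ) (n + 1)).norm_image_sub_le_of_norm_hasDerivWithin_le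
    (f := fun x : ℝ => (x : ℂ) ^ (-s)) (f' := fun x : ℝ => (-s) * (x : ℂ) ^ (-s - 1))
    (C := ‖s‖ * (n : ℝ) ^ (-s.re - 1)) (x := n) (y := x) ?_ ?_ ⟨le_rfl, by linarith⟩ hx
  · simp only [ofReal_natCast] at this
    refine this.trans ?_
    have : ‖x - n‖ ≤ 1 := by
      rw [Real.norm_eq_abs, abs_le]; constructor <;> linarith [hx.1, hx.2]
    calc _ ≤ ‖s‖ * (n : ℝ) ^ (-s.re - 1) * 1 := by gcongr
      _ = _ := mul_one _
  · intro y hy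
    exact (hasDerivAt_ofReal_cpow_const (by linarith [hy.1]) (neg_ne_zero.2 hs0)).hasDerivWithinAt
  · intro y hy
    have hy0 : 0 < y := hn'.trans_le hy.1
    rw [norm_mul, norm_neg, norm_cpow_eq_rpow_re_of_pos hy0]
    simp only [sub_re, neg_re, one_re]
    gcongr ‖s‖ * ?_
    exact Real.rpow_le_rpow_of_nonpos hn' hy.1 (by linarith)

/-- The `n`-th term of the Euler–Maclaurin expansion of `(s - 1) ζ(s) - 1`. -/
noncomputable def zetaCorrection (n : ℕ) (s : ℂ) : ℂ :=
  (s - 1) * (n : ℂ) ^ (-s) - (n : ℂ) ^ (1 - s) + ((n : ℂ) + 1) ^ (1 - s)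

/-- The mean value inequality on `[n, n + 1]` for `(s - 1) n^{-s} (x - n) + x^{1-s}`: its derivative
`(s - 1)(n^{-s} - x^{-s})` is itself a difference, which gains a further power of `n`. -/
theorem norm_zetaCorrection_le {s : ℂ} (hs : 0 ≤ s.re) {n : ℕ} (hn : 0 < n) :
    ‖zetaCorrection n s‖ ≤ ‖s - 1‖ * ‖s‖ * (n : ℝ) ^ (-s.re - 1) := by
  have hn' : (0 : ℝ) < n := by exact_mod_cast hn
  by_cases hs1 : s = 1
  · simp [hs1, zetaCorrection]
  have := (convex_Icc (n : ℝ) (n + 1)).norm_image_sub_le_of_norm_hasDerivWithin_le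
    (f := fun x : ℝ => (s - 1) * (n : ℂ) ^ (-s) * (x - n) + (x : ℂ) ^ (1 - s))
    (f' := fun x : ℝ => (s - 1) * (n : ℂ) ^ (-s) * 1 + (1 - s) * (x : ℂ) ^ (1 - s - 1))
    (C := ‖s - 1‖ * ‖s‖ * (n : ℝ) ^ (-s.re - 1)) (x := n) (y := n + 1) ?_ ?_
    ⟨le_rfl, by linarith⟩ ⟨by linarith, le_rfl⟩
  · convert this using 1
    · congr 1
      simp [zetaCorrection]
      ring
    · simp
  · intro y hy
    have h1 := (hasDerivAt_ofReal_cpow_const (x := y) (by linarith [hy.1]) (sub_ne_zero.2 (Ne.symm hs1)))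
    have h2 := ((Complex.ofRealCLM.hasDerivAt (x := y)).sub_const (n : ℂ)).const_mul ((s - 1) * (n : ℂ) ^ (-s))
    exact (h2.add h1).hasDerivWithinAt
  · intro y hy
    have := norm_natCast_cpow_sub_cpow_le hs hn hy
    have e : (s - 1) * (n : ℂ) ^ (-s) * 1 + (1 - s) * (y : ℂ) ^ (1 - s - 1) =
        -((s - 1) * ((y : ℂ) ^ (-s) - (n : ℂ) ^ (-s))) := by
      rw [show (1 : ℂ) - s - 1 = -s by ring]; ring
    rw [e, norm_neg, norm_mul, mul_assoc]
    gcongr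

theorem summable_natCast_rpow_neg_three_halves : Summable fun n : ℕ => ((n : ℝ) + 1) ^ (-(3 / 2) : ℝ) := by
  have := (summable_nat_add_iff 1).2 (Real.summable_nat_rpow.2 (by norm_num : (-(3/2) : ℝ) < -1))
  simpa using this

theorem norm_zetaCorrection_succ_le {s : ℂ} (hs : 1 / 2 ≤ s.re) (n : ℕ) :
    ‖zetaCorrection (n + 1) s‖ ≤ ‖s - 1‖ * ‖s‖ * ((n : ℝ) + 1) ^ (-(3 / 2) : ℝ) := by
  refine (norm_zetaCorrection_le (by linarith) n.succ_pos).trans ?_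
  push_cast
  gcongr
  · linarith [n.cast_nonneg (α := ℝ)]
  · linarith

/-- The parts `(n + 1)^{1-s} - n^{1-s}` telescope to `-1`, leaving `(s - 1) ∑ n^{-s}`. -/
theorem sub_one_mul_riemannZeta_of_one_lt_re {s : ℂ} (hs : 1 < s.re) :
    (s - 1) * riemannZeta s = 1 + ∑' n : ℕ, zetaCorrection (n + 1) s := by
  have h1 : HasSum (fun n : ℕ => ((n : ℂ) + 1) ^ (-s)) (riemannZeta s) := by
    have := zeta_eq_tsum_one_div_nat_add_one_cpow hs
    rw [this]
    have hsum := (summable_nat_add_iff 1).2 (Complex.summable_one_div_nat_cpow.2 hs)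
    have e : (fun n : ℕ => ((n : ℂ) + 1) ^ (-s)) = fun n : ℕ => 1 / ((n : ℂ) + 1) ^ s := by
      funext n; rw [cpow_neg, one_div]
    rw [e]
    simpa using hsum.hasSum
  have hlim : Tendsto (fun n : ℕ => ((n : ℂ)) ^ (1 - s)) atTop (𝓝 0) := by
    rw [tendsto_zero_iff_norm_tendsto_zero]
    have : Tendsto (fun n : ℕ => (n : ℝ) ^ (-(s.re - 1))) atTop (𝓝 0) :=
      (tendsto_rpow_neg_atTop (by linarith)).comp tendsto_natCast_atTop_atTop
    refine this.congr' ?_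
    filter_upwards [eventually_gt_atTop 0] with n hn
    rw [norm_natCast_cpow_of_pos hn]
    simp
  have h2 : HasSum (fun n : ℕ => (((n + 1 : ℕ) : ℂ) + 1) ^ (1 - s) - ((n + 1 : ℕ) : ℂ) ^ (1 - s)) (0 - 1) := by
    have hs2 : Summable (fun n : ℕ => (((n + 1 : ℕ) : ℂ) + 1) ^ (1 - s) - ((n + 1 : ℕ) : ℂ) ^ (1 - s)) := by
      have e : (fun n : ℕ => (((n + 1 : ℕ) : ℂ) + 1) ^ (1 - s) - ((n + 1 : ℕ) : ℂ) ^ (1 - s)) =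
          fun n => zetaCorrection (n + 1) s - (s - 1) * ((n : ℂ) + 1) ^ (-s) := by
        funext n; simp [zetaCorrection]; ring
      rw [e]
      refine Summable.sub ?_ (h1.summable.mul_left _)
      exact Summable.of_norm_bounded (summable_natCast_rpow_neg_three_halves.mul_left _)
        (norm_zetaCorrection_succ_le (by linarith))
    rw [hs2.hasSum_iff_tendsto_nat]
    have e : ∀ n, ∑ i ∈ Finset.range n, ((((i + 1 : ℕ) : ℂ) + 1) ^ (1 - s) - ((i + 1 : ℕ) : ℂ) ^ (1 - s)) =
        ((n + 1 : ℕ) : ℂ) ^ (1 - s) - 1 := by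
      intro n
      have := Finset.sum_range_sub (fun i : ℕ => ((i + 1 : ℕ) : ℂ) ^ (1 - s)) n
      simp only [Nat.cast_add, Nat.cast_one, zero_add, one_cpow] at this ⊢
      exact this
    simp only [e]
    exact ((tendsto_add_atTop_iff_nat 1).2 hlim).sub_const 1
  have h3 := (h1.mul_left (s - 1)).add h2
  have h4 : HasSum (fun n : ℕ => zetaCorrection (n + 1) s) ((s - 1) * riemannZeta s + (0 - 1)) := by
    have e : (fun n : ℕ => zetaCorrection (n + 1) s) = fun n : ℕ => (s - 1) * ((n : ℂ) + 1) ^ (-s) +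
        ((((n + 1 : ℕ) : ℂ) + 1) ^ (1 - s) - ((n + 1 : ℕ) : ℂ) ^ (1 - s)) := by
      funext n; simp [zetaCorrection]; ring
    rw [e]
    exact h3
  rw [h4.tsum_eq]; ring

/-- Analytic continuation: the series converges locally uniformly on `Re s > 1/2`, and the other
side extends to the entire function `riemannZeta₁`. -/
theorem sub_one_mul_riemannZeta {s : ℂ} (hs : 1 / 2 < s.re) (hs1 : s ≠ 1) :
    (s - 1) * riemannZeta s = 1 + ∑' n : ℕ, zetaCorrection (n + 1) s := by
  set U : Set ℂ := {s | 1 / 2 < s.re} with hU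
  have hUo : IsOpen U := isOpen_lt continuous_const Complex.continuous_re
  have hUc : IsPreconnected U := (convex_halfSpace_re_gt (1 / 2)).isPreconnected
  have hdiff : DifferentiableOn ℂ (fun s => 1 + ∑' n : ℕ, zetaCorrection (n + 1) s) U := by
    intro z hz
    refine DifferentiableWithinAt.const_add _ ?_
    set V : Set ℂ := U ∩ Metric.ball z 1
    have hV : IsOpen V := hUo.inter Metric.isOpen_ball
    have : DifferentiableOn ℂ (fun s => ∑' n : ℕ, zetaCorrection (n + 1) s) V := by
      refine differentiableOn_tsum_of_summable_norm
        (u := fun n : ℕ => ((‖z‖ + 2) * (‖z‖ + 2)) * ((n : ℝ) + 1) ^ (-(3 / 2) : ℝ))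
        (summable_natCast_rpow_neg_three_halves.mul_left _) ?_ hV ?_
      · intro n
        apply Differentiable.differentiableOn
        unfold zetaCorrection
        have h1 : ((n + 1 : ℕ) : ℂ) ≠ 0 := by exact_mod_cast n.succ_ne_zero
        have h2 : ((n + 1 : ℕ) : ℂ) + 1 ≠ 0 := by exact_mod_cast (n + 1).succ_ne_zero
        refine Differentiable.add (Differentiable.sub (Differentiable.mul (by fun_prop) ?_) ?_) ?_
        · exact Differentiable.const_cpow (by fun_prop) (Or.inl h1)
        · exact Differentiable.const_cpow (by fun_prop) (Or.inl h1)
        · exact Differentiable.const_cpow (by fun_prop) (Or.inl h2)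
      · intro n w hw
        refine (norm_zetaCorrection_succ_le (le_of_lt hw.1) n).trans ?_
        have h1 : ‖w‖ ≤ ‖z‖ + 1 := by
          have := norm_sub_norm_le w z
          have h2 := hw.2
          rw [mem_ball_iff_norm] at h2
          linarith
        have h2 : ‖w - 1‖ ≤ ‖w‖ + 1 := by simpa using norm_sub_le w 1
        gcongr <;> linarith
    exact (this.differentiableAt (hV.mem_nhds ⟨hz, by simp⟩)).differentiableWithinAt
  have heq : EqOn riemannZeta₁ (fun s => 1 + ∑' n : ℕ, zetaCorrection (n + 1) s) U := by
    refine AnalyticOnNhd.eqOn_of_preconnected_of_eventuallyEq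
      (differentiable_riemannZeta₁.differentiableOn.analyticOnNhd hUo) (hdiff.analyticOnNhd hUo) hUc
      (z₀ := 2) (by simp [hU]; norm_num) ?_
    have : {s : ℂ | 1 < s.re} ∈ 𝓝 (2 : ℂ) :=
      (isOpen_lt continuous_const Complex.continuous_re).mem_nhds (by simp)
    filter_upwards [this] with w hw
    have hw1 : w ≠ 1 := by rintro rfl; simp at hw
    rw [← sub_one_mul_riemannZeta_of_one_lt_re hw, riemannZeta_eq_inv_sub_mul hw1,
      mul_inv_cancel_left₀ (sub_ne_zero.2 hw1)]
  have := heq hs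
  simp only at this
  rw [← this, riemannZeta_eq_inv_sub_mul hs1, mul_inv_cancel_left₀ (sub_ne_zero.2 hs1)]

/-- Polynomial growth of `ζ` to the right of the critical line. -/
theorem exists_norm_riemannZeta_le :
    ∃ C : ℝ, 0 < C ∧ ∀ s : ℂ, 1 / 2 < s.re → 1 ≤ |s.im| → ‖riemannZeta s‖ ≤ C * ‖s‖ := by
  set D := ∑' n : ℕ, ((n : ℝ) + 1) ^ (-(3 / 2) : ℝ)
  have hD : 0 ≤ D := tsum_nonneg fun n => by positivity
  refine ⟨1 + D, by positivity, fun s hs him => ?_⟩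
  have hs1 : s ≠ 1 := by rintro rfl; simp at him; linarith
  have hb1 : 1 ≤ ‖s - 1‖ := by
    have := Complex.abs_im_le_norm (s - 1); simp at this; linarith
  have hb2 : 1 ≤ ‖s‖ := him.trans (Complex.abs_im_le_norm s)
  have h := sub_one_mul_riemannZeta hs hs1
  have h2 : ‖∑' n : ℕ, zetaCorrection (n + 1) s‖ ≤ ‖s - 1‖ * ‖s‖ * D :=
    tsum_of_norm_bounded (summable_natCast_rpow_neg_three_halves.hasSum.mul_left _)
      (norm_zetaCorrection_succ_le hs.le)
  have h3 : ‖s - 1‖ * ‖riemannZeta s‖ ≤ 1 + ‖s - 1‖ * ‖s‖ * D := by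
    rw [← norm_mul, h]
    exact (norm_add_le _ _).trans (by simpa using h2)
  have h4 : 1 ≤ ‖s - 1‖ * ‖s‖ := by nlinarith
  have h5 : ‖s - 1‖ * ‖riemannZeta s‖ ≤ ‖s - 1‖ * ((1 + D) * ‖s‖) := by nlinarith
  exact le_of_mul_le_mul_left h5 (by linarith)

/-! ### Bounds for `1/ζ` to the right of the critical line. -/

theorem norm_inv_riemannZeta_le {s : ℂ} (hs : 1 < s.re) :
    ‖(riemannZeta s)⁻¹‖ ≤ ∑' n : ℕ, (n : ℝ) ^ (-s.re) := by
  have h1 := ArithmeticFunction.LSeries_zeta_mul_Lseries_moebius hs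
  rw [ArithmeticFunction.LSeries_zeta_eq_riemannZeta hs] at h1
  rw [← eq_inv_of_mul_eq_one_right h1, LSeries]
  refine tsum_of_norm_bounded (Real.summable_nat_rpow.2 (by linarith)).hasSum fun n => ?_
  rcases Nat.eq_zero_or_pos n with rfl | hn
  · rw [LSeries.term_zero, norm_zero]
    positivity
  · rw [LSeries.term_of_ne_zero hn.ne', norm_div, norm_natCast_cpow_of_pos hn,
      Real.rpow_neg n.cast_nonneg, ← one_div]
    gcongr
    have := ArithmeticFunction.abs_moebius_le_one (n := n)
    rw [Complex.norm_intCast]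
    exact_mod_cast this

/-- A holomorphic function without zeros on a disc has a polynomially bounded reciprocal
on smaller discs, by the Borel–Carathéodory theorem applied to its logarithm. -/
theorem norm_inv_le_of_norm_le {f : ℂ → ℂ} {c z : ℂ} {R r B m : ℝ} (hr : 0 ≤ r) (hrR : r < R)
    (hB : 1 < B) (hm : 0 < m) (hf : DifferentiableOn ℂ f (Metric.ball c R))
    (hne : ∀ w ∈ Metric.ball c R, f w ≠ 0) (hfB : ∀ w ∈ Metric.ball c R, ‖f w‖ ≤ m * B)
    (hfm : m ≤ ‖f c‖) (hz : ‖z - c‖ ≤ r) :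
    ‖(f z)⁻¹‖ ≤ m⁻¹ * B ^ (2 * r / (R - r)) := by
  have hR : 0 < R := hr.trans_lt hrR
  have hc : c ∈ Metric.ball c R := Metric.mem_ball_self hR
  have hfd : DifferentiableOn ℂ (fun w => deriv f w / f w) (Metric.ball c R) :=
    (hf.deriv Metric.isOpen_ball).div hf hne
  -- A primitive `g` of `f'/f` is a logarithm of `f` up to a constant.
  obtain ⟨g, hg⟩ := hfd.isExactOn_ball
  have hconst : ∀ w ∈ Metric.ball c R, f w * exp (-g w) = f c * exp (-g c) := by
    intro w hw
    refine IsOpen.is_const_of_deriv_eq_zero (f := fun w => f w * exp (-g w)) Metric.isOpen_ball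
      (convex_ball c R).isPreconnected ?_ ?_ hw hc
    · exact hf.mul fun w hw => ((hg w hw).differentiableAt.neg.cexp).differentiableWithinAt
    · intro w hw
      have h1 := (hf.differentiableAt (Metric.isOpen_ball.mem_nhds hw)).hasDerivAt
      have h2 := h1.mul ((hg w hw).neg.cexp)
      have h3 : deriv (fun w => f w * exp (-g w)) w = _ := h2.deriv
      rw [h3]
      have := hne w hw
      simp only [Pi.zero_apply]
      field_simp
      ring
  have hexp : ∀ w ∈ Metric.ball c R, f w = f c * exp (g w - g c) := by
    intro w hw
    have h := hconst w hw
    rw [exp_neg] at h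
    have h0 := exp_ne_zero (g w)
    rw [sub_eq_add_neg, exp_add]
    field_simp at h
    rw [h]; ring
  have hfc : 0 < ‖f c‖ := hm.trans_le hfm
  set L : ℂ → ℂ := fun w => g (c + w) - g c with hL
  have hmap : ∀ w ∈ Metric.ball (0 : ℂ) R, c + w ∈ Metric.ball c R := by
    intro w hw
    simpa [mem_ball_iff_norm] using hw
  have hzr : z - c ∈ Metric.ball (0 : ℂ) R := by
    rw [mem_ball_zero_iff]; exact hz.trans_lt hrR
  -- `L` is the branch of `log (f / f c)` vanishing at the centre. Its real part is at most `log B`,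
  -- because `‖f‖ ≤ m B` and `‖f c‖ ≥ m`.
  have hLb : ‖L (z - c)‖ ≤ 2 * Real.log B * ‖z - c‖ / (R - ‖z - c‖) := by
    refine Complex.borelCaratheodory_zero (Real.log_pos hB) ?_ ?_ hR hzr (by simp [hL])
    · intro w hw
      have := (hg _ (hmap w hw)).differentiableAt
      refine DifferentiableAt.differentiableWithinAt (DifferentiableAt.sub_const ?_ _)
      exact DifferentiableAt.comp w this (by fun_prop)
    · intro w hw
      have h1 := hfB _ (hmap w hw)
      rw [hexp _ (hmap w hw), norm_mul, norm_exp] at h1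
      have h2 : ‖f c‖ * Real.exp (L w).re ≤ ‖f c‖ * B := h1.trans (by gcongr)
      have h3 := le_of_mul_le_mul_left h2 hfc
      exact (Real.le_log_iff_exp_le (by linarith)).2 h3
  have hLb' : ‖L (z - c)‖ ≤ Real.log B * (2 * r / (R - r)) := by
    refine hLb.trans ?_
    have hlog := Real.log_pos hB
    calc 2 * Real.log B * ‖z - c‖ / (R - ‖z - c‖) ≤ 2 * Real.log B * r / (R - r) := by
          gcongr
      _ = _ := by ring
  have hz' : z ∈ Metric.ball c R := by simpa using hmap _ hzr
  have hLz : L (z - c) = g z - g c := by simp [hL]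
  rw [hexp z hz', mul_inv, norm_mul, norm_inv, ← exp_neg, norm_exp, ← hLz]
  have hre : (-L (z - c)).re ≤ Real.log B * (2 * r / (R - r)) :=
    (Complex.re_le_norm _).trans (by rwa [norm_neg])
  rw [Real.rpow_def_of_pos (by linarith)]
  gcongr

/-- The disc of radius `3/2` about `2 + it` stays in `Re s > 1/2`, where RH excludes zeros at these
heights. Reaching `3/4 + it` takes radius `5/4`, and `2r/(R - r) = 10`. -/
theorem exists_norm_inv_riemannZeta_three_quarters_le (hRH : RiemannHypothesis) :
    ∃ C : ℝ, 0 < C ∧ ∀ t : ℝ, 3 ≤ t → ‖(riemannZeta (3 / 4 + t * I))⁻¹‖ ≤ C * t ^ (10 : ℝ) := by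
  obtain ⟨C, hC, hζ⟩ := exists_norm_riemannZeta_le
  set S := ∑' n : ℕ, (n : ℝ) ^ (-2 : ℝ) with hS
  have hSpos : 0 < S := by
    refine (Real.summable_nat_rpow.2 (by norm_num)).tsum_pos (fun n => by positivity) 1 (by simp)
  refine ⟨S * (6 * C * S + 1) ^ (10 : ℝ), by positivity, fun t ht => ?_⟩
  have ht0 : (0 : ℝ) < t := by linarith
  have him : ∀ w ∈ Metric.ball (2 + t * I) (3 / 2), 1 / 2 < w.re ∧ 3 / 2 ≤ w.im ∧ ‖w‖ ≤ 6 * t := by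
    intro w hw
    rw [mem_ball_iff_norm] at hw
    have h1 := (Complex.abs_re_le_norm (w - (2 + t * I))).trans_lt hw
    have h2 := (Complex.abs_im_le_norm (w - (2 + t * I))).trans_lt hw
    simp [abs_lt] at h1 h2
    refine ⟨by linarith, by linarith, ?_⟩
    refine (Complex.norm_le_abs_re_add_abs_im w).trans ?_
    rw [abs_of_pos (by linarith), abs_of_pos (by linarith)]
    linarith
  have := norm_inv_le_of_norm_le (f := riemannZeta) (c := 2 + t * I) (z := 3 / 4 + t * I) (R := 3 / 2)
    (r := 5 / 4) (B := 6 * C * S * t + 1) (m := S⁻¹) (by norm_num) (by norm_num)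
    (by have : 0 < 6 * C * S * t := by positivity
        linarith) (by positivity) ?_ ?_ ?_ ?_ ?_
  · refine this.trans ?_
    rw [inv_inv, show (2 * (5 / 4) / (3 / 2 - 5 / 4) : ℝ) = 10 by norm_num, mul_assoc S,
      ← Real.mul_rpow (by positivity) (by positivity)]
    gcongr
    nlinarith
  · intro w hw
    refine (differentiableAt_riemannZeta ?_).differentiableWithinAt
    rintro rfl
    have := (him 1 hw).2.1
    simp at this; linarith
  · intro w hw h0
    have h1 := him w hw
    have := re_eq_half_of_riemannZeta_eq_zero hRH h0 (by linarith)
    linarith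
  · intro w hw
    have h1 := him w hw
    refine (hζ w h1.1 (by rw [abs_of_pos] <;> linarith)).trans ?_
    have : S⁻¹ * (6 * C * S * t + 1) = C * (6 * t) + S⁻¹ := by field_simp
    rw [this]
    have h3 : C * ‖w‖ ≤ C * (6 * t) := by gcongr; exact h1.2.2
    have : 0 < S⁻¹ := by positivity
    linarith
  · have h1 := norm_inv_riemannZeta_le (s := 2 + t * I) (by simp)
    have e : (2 + t * I : ℂ).re = 2 := by simp
    rw [e, ← hS, norm_inv] at h1
    refine inv_le_of_inv_le₀ ?_ h1
    exact norm_pos_iff.2 (riemannZeta_ne_zero_of_one_lt_re (by simp))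
  · rw [show (3 / 4 + t * I - (2 + t * I) : ℂ) = ((-(5 / 4) : ℝ) : ℂ) by push_cast; ring, Complex.norm_real]
    norm_num

/-! ### The Gamma factor and bounds for `1/ζ` to the left of the critical line. -/

theorem Complex.norm_betaIntegral_le (u v : ℂ) :
    ‖betaIntegral u v‖ ≤ ‖betaIntegral (u.re : ℂ) (v.re : ℂ)‖ := by
  have e : betaIntegral (u.re : ℂ) (v.re : ℂ) =
      ((∫ x : ℝ in (0 : ℝ)..1, x ^ (u.re - 1) * (1 - x) ^ (v.re - 1) : ℝ) : ℂ) := by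
    rw [betaIntegral, ← intervalIntegral.integral_ofReal]
    refine intervalIntegral.integral_congr fun x hx => ?_
    rw [uIcc_of_le zero_le_one] at hx
    push_cast
    rw [ofReal_cpow hx.1, ofReal_cpow (by linarith [hx.2])]
    push_cast
    rfl
  have hpos : 0 ≤ ∫ x : ℝ in (0 : ℝ)..1, x ^ (u.re - 1) * (1 - x) ^ (v.re - 1) := by
    refine intervalIntegral.integral_nonneg zero_le_one fun x hx => ?_
    have : 0 ≤ 1 - x := by linarith [hx.2]
    have := hx.1
    positivity
  rw [e, Complex.norm_real, Real.norm_of_nonneg hpos, betaIntegral]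
  refine (intervalIntegral.norm_integral_le_integral_norm zero_le_one).trans (le_of_eq ?_)
  rw [intervalIntegral.integral_of_le zero_le_one, intervalIntegral.integral_of_le zero_le_one,
    integral_Ioc_eq_integral_Ioo, integral_Ioc_eq_integral_Ioo]
  refine setIntegral_congr_fun measurableSet_Ioo fun x hx => ?_
  have h1 : (1 - (x : ℂ)) = ((1 - x : ℝ) : ℂ) := by push_cast; rfl
  simp only [norm_mul]
  rw [h1, norm_cpow_eq_rpow_re_of_pos hx.1, norm_cpow_eq_rpow_re_of_pos (by linarith [hx.2])]
  simp

/-- On horizontal lines, `|Γ(σ + it)| / Γ(σ)` is nondecreasing in `σ > 0`. -/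
theorem Complex.Gamma_div_mul_norm_Gamma_le {σ δ : ℝ} (hσ : 0 < σ) (hδ : 0 < δ) (t : ℝ) :
    Real.Gamma (σ + δ) / Real.Gamma σ * ‖Gamma (σ + t * I)‖ ≤ ‖Gamma ((σ + δ : ℝ) + t * I)‖ := by
  -- Compare `Γ(s) Γ(δ) = Γ(s + δ) B(s, δ)` at `s = σ + it` and at `s = σ`, where the Beta integral
  -- is the larger in modulus. With the exact value on `σ = 1`, this gives lower bounds for `Γ`
  -- without Stirling's formula.
  have h1 := Gamma_mul_Gamma_eq_betaIntegral (s := σ + t * I) (t := δ) (by simpa) (by simpa)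
  have h2 := Gamma_mul_Gamma_eq_betaIntegral (s := σ) (t := δ) (by simpa) (by simpa)
  have h3 := Complex.norm_betaIntegral_le (σ + t * I) δ
  simp only [add_re, ofReal_re, mul_re, I_re, mul_zero, ofReal_im, I_im, mul_one, sub_self, add_zero] at h3
  have e : (σ + t * I + δ : ℂ) = ((σ + δ : ℝ) : ℂ) + t * I := by push_cast; ring
  rw [e] at h1
  have hΓδ := Real.Gamma_pos_of_pos hδ
  have hΓσ := Real.Gamma_pos_of_pos hσ
  have hΓ := Real.Gamma_pos_of_pos (add_pos hσ hδ)
  have n1 := congrArg norm h1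
  have n2 := congrArg norm h2
  rw [norm_mul, norm_mul, Gamma_ofReal, Complex.norm_real, Real.norm_of_nonneg hΓδ.le] at n1
  rw [norm_mul, norm_mul, ← ofReal_add, Gamma_ofReal, Gamma_ofReal, Gamma_ofReal, Complex.norm_real,
    Complex.norm_real, Complex.norm_real, Real.norm_of_nonneg hΓδ.le, Real.norm_of_nonneg hΓσ.le,
    Real.norm_of_nonneg hΓ.le] at n2
  rw [div_mul_eq_mul_div, div_le_iff₀ hΓσ]
  have h4 : ‖Gamma (σ + t * I)‖ * Real.Gamma δ ≤
      ‖Gamma ((σ + δ : ℝ) + t * I)‖ * ‖betaIntegral (σ : ℂ) (δ : ℂ)‖ := by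
    rw [n1]; gcongr
  have h5 := mul_le_mul_of_nonneg_left h4 hΓ.le
  have h6 : Real.Gamma δ * (Real.Gamma (σ + δ) * ‖Gamma (σ + t * I)‖) ≤
      Real.Gamma δ * (‖Gamma ((σ + δ : ℝ) + t * I)‖ * Real.Gamma σ) := by
    calc _ = Real.Gamma (σ + δ) * (‖Gamma (σ + t * I)‖ * Real.Gamma δ) := by ring
      _ ≤ _ := h5
      _ = ‖Gamma ((σ + δ : ℝ) + t * I)‖ * (Real.Gamma (σ + δ) * ‖betaIntegral (σ : ℂ) (δ : ℂ)‖) := by ring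
      _ = _ := by rw [← n2]; ring
  exact le_of_mul_le_mul_left h6 hΓδ

/-- The reflection formula at `it`, with `Γ(1 - it)` the conjugate of `Γ(1 + it)` and `Γ(1 + it) =
it Γ(it)`. -/
theorem Complex.norm_Gamma_one_add_mul_I_sq {t : ℝ} (ht : 0 < t) :
    ‖Gamma (1 + t * I)‖ ^ 2 = Real.pi * t / Real.sinh (Real.pi * t) := by
  have ht0 : (t * I : ℂ) ≠ 0 := by simp [ht.ne']
  have h1 := Complex.Gamma_mul_Gamma_one_sub (t * I)
  have h2 : Gamma (1 + t * I) = t * I * Gamma (t * I) := by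
    rw [add_comm, Gamma_add_one _ ht0]
  have h3 : Gamma (1 - t * I) = (starRingEnd ℂ) (Gamma (1 + t * I)) := by
    rw [← Gamma_conj]; congr 1; simp [sub_eq_add_neg]
  have h4 : ‖Gamma (1 - t * I)‖ = ‖Gamma (1 + t * I)‖ := by rw [h3, RCLike.norm_conj]
  have hsin : ‖sin (Real.pi * (t * I))‖ = Real.sinh (Real.pi * t) := by
    rw [← mul_assoc, sin_mul_I, norm_mul, norm_I, mul_one, ← ofReal_mul, ← ofReal_sinh, Complex.norm_real,
      Real.norm_of_nonneg]
    exact Real.sinh_nonneg_iff.2 (by positivity)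
  have h5 := congrArg norm h1
  rw [norm_mul, norm_div, hsin, h4, Complex.norm_real, Real.norm_of_nonneg Real.pi_pos.le] at h5
  have h6 := congrArg norm h2
  rw [norm_mul, norm_mul, norm_I, Complex.norm_real, Real.norm_of_nonneg ht.le, mul_one] at h6
  calc _ = t * (‖Gamma (t * I)‖ * ‖Gamma (1 + t * I)‖) := by rw [sq]; nth_rw 1 [h6]; ring
    _ = _ := by rw [h5]; ring

/-- Follows from `|cos z|² = cos² (Re z) + sinh² (Im z)`. -/
theorem Complex.abs_sinh_im_le_norm_cos (z : ℂ) : |Real.sinh z.im| ≤ ‖cos z‖ := by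
  have h : cos z = ((Real.cos z.re * Real.cosh z.im : ℝ) : ℂ) - ((Real.sin z.re * Real.sinh z.im : ℝ) : ℂ) * I := by
    conv_lhs => rw [← re_add_im z, cos_add_mul_I]
    push_cast; rfl
  have h2 : ‖cos z‖ ^ 2 = (Real.cos z.re * Real.cosh z.im) ^ 2 + (Real.sin z.re * Real.sinh z.im) ^ 2 := by
    rw [h, Complex.sq_norm, Complex.normSq_apply]
    simp only [sub_re, ofReal_re, mul_re, I_re, ofReal_im, I_im, sub_im, mul_im]
    ring
  have h3 : ‖cos z‖ ^ 2 = Real.cos z.re ^ 2 + Real.sinh z.im ^ 2 := by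
    rw [h2, mul_pow, mul_pow, Real.cosh_sq, Real.sin_sq]; ring
  apply abs_le_of_sq_le_sq' _ (norm_nonneg _) |> fun h => abs_le.2 h
  rw [h3]; nlinarith [sq_nonneg (Real.cos z.re)]

/-- The decay of `Γ` cancels the growth of the cosine. With `y = πt/2` one has `(|Γ(1 + it)| sinh
y)² = πt sinh y / (2 cosh y)`, and `cosh y ≤ (3/2) sinh y` makes this at least `πt/3 ≥ t`. -/
theorem exists_le_norm_Gamma_one_mul_norm_cos :
    ∃ c : ℝ, 0 < c ∧ ∀ σ t : ℝ, 1 ≤ t →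
      c * t ^ (1 / 2 : ℝ) ≤ ‖Gamma (1 + t * I)‖ * ‖cos (Real.pi * (σ + t * I) / 2)‖ := by
  refine ⟨1, one_pos, fun σ t ht => ?_⟩
  have ht0 : 0 < t := by linarith
  set y := Real.pi * t / 2 with hy
  have hy1 : 1 ≤ y := by rw [hy]; nlinarith [Real.pi_gt_three]
  have hs : 0 < Real.sinh y := Real.sinh_pos_iff.2 (by linarith)
  have h1 : Real.sinh y ≤ ‖cos (Real.pi * (σ + t * I) / 2)‖ := by
    have := Complex.abs_sinh_im_le_norm_cos (Real.pi * (σ + t * I) / 2)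
    have e : (Real.pi * (σ + t * I) / 2 : ℂ).im = y := by
      rw [show (Real.pi * (σ + t * I) / 2 : ℂ) = ((Real.pi * σ / 2 : ℝ) : ℂ) + ((Real.pi * t / 2 : ℝ) : ℂ) * I by
        push_cast; ring]
      simp [hy]
    rw [e, abs_of_pos hs] at this
    exact this
  have h2 := Complex.norm_Gamma_one_add_mul_I_sq ht0
  have h3 : Real.sinh (Real.pi * t) = 2 * Real.sinh y * Real.cosh y := by
    rw [← Real.sinh_two_mul]; congr 1; rw [hy]; ring
  have hc : 0 < Real.cosh y := Real.cosh_pos y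
  have h4 : Real.cosh y ≤ 3 / 2 * Real.sinh y := by
    have e1 := Real.exp_pos (-y)
    have e2 : 5 * Real.exp (-y) ≤ Real.exp y := by
      have : (5:ℝ) ≤ Real.exp y * Real.exp y := by
        rw [← Real.exp_add]
        have := Real.add_one_le_exp (y + y)
        have h7 : (2.7:ℝ) < Real.exp 1 := by linarith [Real.exp_one_gt_d9]
        have h8 : Real.exp (1+1) ≤ Real.exp (y+y) := Real.exp_le_exp.2 (by linarith)
        rw [Real.exp_add] at h8
        nlinarith
      calc 5 * Real.exp (-y) ≤ Real.exp y * Real.exp y * Real.exp (-y) := by gcongr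
        _ = Real.exp y := by rw [mul_assoc, ← Real.exp_add]; simp
    rw [Real.cosh_eq, Real.sinh_eq]; linarith
  have h5 : t ≤ (‖Gamma (1 + t * I)‖ * Real.sinh y) ^ 2 := by
    rw [mul_pow, h2, h3, div_mul_eq_mul_div, le_div_iff₀ (by positivity)]
    have : t * (2 * Real.sinh y * Real.cosh y) ≤ t * (2 * Real.sinh y * (3 / 2 * Real.sinh y)) := by gcongr
    refine this.trans ?_
    have h9 : 3 * (t * Real.sinh y ^ 2) ≤ Real.pi * (t * Real.sinh y ^ 2) := by
      gcongr; exact Real.pi_gt_three.le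
    nlinarith
  rw [one_mul, ← Real.sqrt_eq_rpow]
  refine (Real.sqrt_le_sqrt h5).trans ?_
  rw [Real.sqrt_sq (by positivity)]
  gcongr

theorem norm_riemannZeta_neg_im (σ t : ℝ) : ‖riemannZeta (σ - t * I)‖ = ‖riemannZeta (σ + t * I)‖ := by
  rw [show (σ - t * I : ℂ) = (starRingEnd ℂ) (σ + t * I) by simp [sub_eq_add_neg], riemannZeta_conj,
    RCLike.norm_conj]

/-- Norm form of the functional equation of `ζ`. -/
theorem norm_riemannZeta_one_sub_re (σ : ℝ) {t : ℝ} (ht : 0 < t) :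
    ‖riemannZeta ((1 - σ : ℝ) + t * I)‖ = 2 * (2 * Real.pi) ^ (-σ) *
      (‖Gamma (σ + t * I)‖ * ‖cos (Real.pi * (σ + t * I) / 2)‖) * ‖riemannZeta (σ + t * I)‖ := by
  have him : (σ + t * I : ℂ).im = t := by simp
  have h := riemannZeta_one_sub (s := σ + t * I) ?_ ?_
  · rw [← norm_riemannZeta_neg_im]
    have e : (((1 - σ : ℝ) : ℂ) - t * I) = 1 - (σ + t * I) := by push_cast; ring
    have hp : ‖(2 * Real.pi : ℂ) ^ (-(σ + t * I : ℂ))‖ = (2 * Real.pi) ^ (-σ) := by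
      rw [show (2 * Real.pi : ℂ) = ((2 * Real.pi : ℝ) : ℂ) by push_cast; rfl,
        norm_cpow_eq_rpow_re_of_pos (by positivity)]
      simp
    rw [e, h, norm_mul, norm_mul, norm_mul, norm_mul, hp]
    simp only [norm_ofNat]
    ring
  · intro n hn
    rw [hn] at him
    simp at him
    linarith
  · intro hn
    rw [hn] at him
    simp at him
    linarith

/-- The functional equation reflects the line to `σ = 1 + δ`, where `1/ζ` is bounded. The true decay
is `t^{-1/2-δ}`; comparing with `Γ(1 + it)` gives up `t^{-δ}`, and `t^{-1/2}` is all that the left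
side needs. -/
theorem exists_norm_inv_riemannZeta_neg_le {δ : ℝ} (hδ : 0 < δ) :
    ∃ C : ℝ, 0 < C ∧ ∀ t : ℝ, 1 ≤ t →
      ‖(riemannZeta ((-δ : ℝ) + t * I))⁻¹‖ ≤ C * t ^ (-(1 / 2) : ℝ) := by
  obtain ⟨c, hc, hΓ⟩ := exists_le_norm_Gamma_one_mul_norm_cos
  set S := ∑' n : ℕ, (n : ℝ) ^ (-(1 + δ)) with hS
  have hSpos : 0 < S :=
    (Real.summable_nat_rpow.2 (by linarith)).tsum_pos (fun n => by positivity) 1 (by simp)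
  set p := 2 * (2 * Real.pi) ^ (-(1 + δ)) with hp
  have hppos : 0 < p := by positivity
  set q := Real.Gamma (1 + δ) / Real.Gamma 1 with hq
  have hqpos : 0 < q := div_pos (Real.Gamma_pos_of_pos (by linarith)) (Real.Gamma_pos_of_pos one_pos)
  refine ⟨S * (p * (q * c))⁻¹, by positivity, fun t ht => ?_⟩
  have ht0 : 0 < t := by linarith
  have h1 := norm_riemannZeta_one_sub_re (1 + δ) ht0
  rw [show 1 - (1 + δ) = -δ by ring, ← hp] at h1
  have h2 := Complex.Gamma_div_mul_norm_Gamma_le one_pos hδ t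
  rw [← hq, ofReal_one] at h2
  have h3 := hΓ (1 + δ) t ht
  have h4 := norm_inv_riemannZeta_le (s := (1 + δ : ℝ) + t * I) (by simpa)
  have e : (((1 + δ : ℝ) : ℂ) + t * I).re = 1 + δ := by simp
  rw [e, ← hS] at h4
  have h5 : q * (c * t ^ (1 / 2 : ℝ)) ≤
      ‖Gamma ((1 + δ : ℝ) + t * I)‖ * ‖cos (Real.pi * ((1 + δ : ℝ) + t * I) / 2)‖ := by
    calc _ ≤ q * (‖Gamma (1 + t * I)‖ * ‖cos (Real.pi * ((1 + δ : ℝ) + t * I) / 2)‖) := by gcongr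
      _ = (q * ‖Gamma (1 + t * I)‖) * ‖cos (Real.pi * ((1 + δ : ℝ) + t * I) / 2)‖ := by ring
      _ ≤ _ := by gcongr
  rw [norm_inv, h1, mul_inv, mul_inv, ← norm_inv (riemannZeta _)]
  calc p⁻¹ * (‖Gamma ((1 + δ : ℝ) + t * I)‖ * ‖cos (Real.pi * ((1 + δ : ℝ) + t * I) / 2)‖)⁻¹ *
        ‖(riemannZeta ((1 + δ : ℝ) + t * I))⁻¹‖ ≤ p⁻¹ * (q * (c * t ^ (1 / 2 : ℝ)))⁻¹ * S := by
        gcongr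
    _ = _ := by rw [Real.rpow_neg ht0.le]; simp only [mul_inv]; ring

/-- Reflection carries `3/4` to `1/4`. The Gamma comparison starts from `σ = 1`, so it bounds `Γ(7/4
+ it) = s Γ(s)` with `s = 3/4 + it`; dividing by `|s| ≤ 2t` raises the exponent from 10 to 11. -/
theorem exists_norm_inv_riemannZeta_quarter_le (hRH : RiemannHypothesis) :
    ∃ C : ℝ, 0 < C ∧ ∀ t : ℝ, 3 ≤ t → ‖(riemannZeta ((1 / 4 : ℝ) + t * I))⁻¹‖ ≤ C * t ^ (11 : ℝ) ∧
      ‖(riemannZeta ((3 / 4 : ℝ) + t * I))⁻¹‖ ≤ C * t ^ (11 : ℝ) := by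
  obtain ⟨c, hc, hΓ⟩ := exists_le_norm_Gamma_one_mul_norm_cos
  obtain ⟨S, hS, hζ⟩ := exists_norm_inv_riemannZeta_three_quarters_le hRH
  set p := 2 * (2 * Real.pi) ^ (-(3 / 4 : ℝ)) with hp
  have hppos : 0 < p := by positivity
  set q := Real.Gamma (1 + 3 / 4) / Real.Gamma 1 with hq
  have hqpos : 0 < q := div_pos (Real.Gamma_pos_of_pos (by linarith)) (Real.Gamma_pos_of_pos one_pos)
  refine ⟨2 * S * (p * (q * c))⁻¹ + S, by positivity, fun t ht => ?_⟩
  have ht0 : 0 < t := by linarith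
  have ht1 : 1 ≤ t := by linarith
  have h4 := hζ t ht
  rw [show (3 / 4 : ℂ) = ((3 / 4 : ℝ) : ℂ) by push_cast; rfl] at h4
  have h11 : t ^ (11 : ℝ) = t * t ^ (10 : ℝ) := by
    rw [show (11 : ℝ) = 1 + 10 by norm_num, Real.rpow_add ht0, Real.rpow_one]
  have h10 : t ^ (10 : ℝ) ≤ t ^ (11 : ℝ) := Real.rpow_le_rpow_of_exponent_le ht1 (by norm_num)
  constructor
  · have h1 := norm_riemannZeta_one_sub_re (3 / 4) ht0
    rw [show (1 : ℝ) - 3 / 4 = 1 / 4 by norm_num, ← hp] at h1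
    have h2 := Complex.Gamma_div_mul_norm_Gamma_le one_pos (show (0 : ℝ) < 3 / 4 by norm_num) t
    rw [← hq, ofReal_one] at h2
    have h3 := hΓ (3 / 4) t (by linarith)
    set s : ℂ := ((3 / 4 : ℝ) : ℂ) + t * I with hs
    have hs0 : s ≠ 0 := by intro h; have := congrArg Complex.re h; simp [hs] at this
    have hG : Gamma ((1 + 3 / 4 : ℝ) + t * I) = s * Gamma s := by
      rw [← Gamma_add_one _ hs0]; congr 1; rw [hs]; push_cast; ring
    have hsn : ‖s‖ ≤ 2 * t := by
      refine (Complex.norm_le_abs_re_add_abs_im s).trans ?_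
      have e1 : s.re = 3 / 4 := by simp [hs]
      have e2 : s.im = t := by simp [hs]
      rw [e1, e2, abs_of_pos ht0, abs_of_pos (by norm_num)]
      linarith
    rw [hG, norm_mul] at h2
    have ht2 : 1 ≤ t ^ (1 / 2 : ℝ) := Real.one_le_rpow ht1 (by norm_num)
    have h5 : q * c / (2 * t) ≤ ‖Gamma s‖ * ‖cos (Real.pi * s / 2)‖ := by
      rw [div_le_iff₀ (by positivity)]
      calc q * c = q * (c * 1) := by ring
        _ ≤ q * (c * t ^ (1 / 2 : ℝ)) := by gcongr
        _ ≤ q * (‖Gamma (1 + t * I)‖ * ‖cos (Real.pi * s / 2)‖) := by gcongr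
        _ = (q * ‖Gamma (1 + t * I)‖) * ‖cos (Real.pi * s / 2)‖ := by ring
        _ ≤ (2 * t * ‖Gamma s‖) * ‖cos (Real.pi * s / 2)‖ :=
            mul_le_mul_of_nonneg_right (h2.trans (by gcongr)) (norm_nonneg _)
        _ = _ := by ring
    rw [norm_inv, h1, mul_inv, mul_inv, ← norm_inv (riemannZeta _)]
    calc p⁻¹ * (‖Gamma s‖ * ‖cos (Real.pi * s / 2)‖)⁻¹ * ‖(riemannZeta s)⁻¹‖
        ≤ p⁻¹ * (q * c / (2 * t))⁻¹ * (S * t ^ (10 : ℝ)) := by gcongr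
      _ = 2 * S * (p * (q * c))⁻¹ * t ^ (11 : ℝ) := by rw [h11]; field_simp
      _ ≤ _ := by gcongr; linarith
  · refine h4.trans ?_
    gcongr
    have : 0 < 2 * S * (p * (q * c))⁻¹ := by positivity
    linarith

/-! ### Contour formula for the zero sums. -/

/-- The sum `∑ r^ρ / ζ'(ρ)` over the nontrivial zeros with `T₁ < γ < T₂`. -/
noncomputable def zetaZeroSum (T₁ T₂ r : ℝ) : ℂ :=
  ∑ ρ ∈ (zetaZerosBetween_finite T₁ T₂).toFinset, (deriv riemannZeta ρ)⁻¹ * (r : ℂ) ^ ρ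

/-- The integral of `r^s / ζ(s)` along the segment from `a + iT₁` to `a + iT₂`, divided by `i`. -/
noncomputable def verticalIntegral (T₁ T₂ a r : ℝ) : ℂ :=
  ∫ y in T₁..T₂, (r : ℂ) ^ (a + y * I : ℂ) / riemannZeta (a + y * I)

theorem Real.rpow_le_rpow_add_rpow {r a b x : ℝ} (hr : 0 < r) (hx : x ∈ Icc a b) :
    r ^ x ≤ r ^ a + r ^ b := by
  rcases le_total 1 r with h | h
  · exact (Real.rpow_le_rpow_of_exponent_le h hx.2).trans
      (le_add_of_nonneg_left (Real.rpow_nonneg hr.le _))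
  · exact (Real.rpow_le_rpow_of_exponent_ge hr h hx.1).trans
      (le_add_of_nonneg_right (Real.rpow_nonneg hr.le _))

theorem norm_integral_horizontal_le {K : ℝ → ℝ} {a b t δ r : ℝ} (hab : a ≤ b) (ha : -1 ≤ a)
    (hb : b ≤ 2) (hδ : 0 < δ) (hr : 0 < r) (ht : IsGoodHeight K t) :
    ‖∫ x in a..b, (r : ℂ) ^ (x + t * I : ℂ) / riemannZeta (x + t * I)‖ ≤
      (r ^ a + r ^ b) * (K δ * t ^ δ) * (b - a) := by
  rw [← abs_of_nonneg (sub_nonneg.2 hab)]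
  refine intervalIntegral.norm_integral_le_of_norm_le_const fun x hx => ?_
  rw [uIoc_of_le hab] at hx
  have h := (ht x (by linarith [hx.1]) (by linarith [hx.2])).2 δ hδ
  rw [div_eq_mul_inv, norm_mul, norm_cpow_eq_rpow_re_of_pos hr]
  have e : (x + t * I : ℂ).re = x := by simp
  rw [e]
  exact mul_le_mul (Real.rpow_le_rpow_add_rpow hr (Ioc_subset_Icc_self hx)) h (norm_nonneg _)
    (by positivity)

/-- The residue theorem for `r^s / ζ(s)`, in which only the two horizontal sides are estimated; the
vertical sides are treated differently in each application. -/
theorem norm_zetaZeroSum_sub_le (hRH : RiemannHypothesis) {K : ℝ → ℝ} {a b T₁ T₂ δ r : ℝ}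
    (ha : -1 ≤ a) (ha' : a < 1 / 2) (hb' : 1 / 2 < b) (hb : b ≤ 2) (hδ : 0 < δ) (hr : 0 < r)
    (hT₁ : 0 < T₁) (h12 : T₁ ≤ T₂)
    (hsimple : ∀ s, riemannZeta s = 0 → T₁ ≤ s.im → deriv riemannZeta s ≠ 0)
    (h1 : IsGoodHeight K T₁) (h2 : IsGoodHeight K T₂) :
    ‖2 * Real.pi * zetaZeroSum T₁ T₂ r -
        (verticalIntegral T₁ T₂ b r - verticalIntegral T₁ T₂ a r)‖ ≤
      (r ^ a + r ^ b) * (K δ * T₁ ^ δ + K δ * T₂ ^ δ) * (b - a) := by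
  have hF : Differentiable ℂ fun s : ℂ => (r : ℂ) ^ s := fun s =>
    DifferentiableAt.const_cpow differentiableAt_id (Or.inl (by exact_mod_cast hr.ne'))
  have hne : ∀ t, IsGoodHeight K t → riemannZeta (1 / 2 + t * I) ≠ 0 := by
    intro t ht
    have := (ht (1 / 2) (by norm_num) (by norm_num)).1
    rwa [show ((1 / 2 : ℝ) : ℂ) = 1 / 2 by push_cast; rfl] at this
  have key := rectBoundaryIntegral_div_riemannZeta hRH hF ha' hb' hT₁ h12 hsimple
    (hne _ h1) (hne _ h2)
  unfold rectBoundaryIntegral at key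
  have e : 2 * Real.pi * zetaZeroSum T₁ T₂ r -
      (verticalIntegral T₁ T₂ b r - verticalIntegral T₁ T₂ a r) =
      -I * ((∫ x in a..b, (r : ℂ) ^ (x + T₁ * I : ℂ) / riemannZeta (x + T₁ * I)) -
        ∫ x in a..b, (r : ℂ) ^ (x + T₂ * I : ℂ) / riemannZeta (x + T₂ * I)) := by
    unfold zetaZeroSum verticalIntegral
    set S := ∑ ρ ∈ (zetaZerosBetween_finite T₁ T₂).toFinset, (deriv riemannZeta ρ)⁻¹ * (r : ℂ) ^ ρ
    set A₁ := ∫ x in a..b, (r : ℂ) ^ (x + T₁ * I : ℂ) / riemannZeta (x + T₁ * I)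
    set A₂ := ∫ x in a..b, (r : ℂ) ^ (x + T₂ * I : ℂ) / riemannZeta (x + T₂ * I)
    set V₁ := ∫ y in T₁..T₂, (r : ℂ) ^ (a + y * I : ℂ) / riemannZeta (a + y * I)
    set V₂ := ∫ y in T₁..T₂, (r : ℂ) ^ (b + y * I : ℂ) / riemannZeta (b + y * I)
    linear_combination I * key + (2 * Real.pi * S - V₂ + V₁) * I_sq
  rw [e, norm_mul, norm_neg, norm_I, one_mul]
  refine (norm_sub_le _ _).trans ?_
  have g1 := norm_integral_horizontal_le (by linarith) ha hb hδ hr h1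
  have g2 := norm_integral_horizontal_le (by linarith) ha hb hδ hr h2
  linarith

theorem norm_verticalIntegral_le {a r T₁ T₂ D : ℝ} (hr : 0 < r) (h12 : T₁ ≤ T₂)
    (hD : ∀ t, T₁ ≤ t → t ≤ T₂ → ‖(riemannZeta (a + t * I))⁻¹‖ ≤ D) :
    ‖verticalIntegral T₁ T₂ a r‖ ≤ r ^ a * D * (T₂ - T₁) := by
  rw [← abs_of_nonneg (sub_nonneg.2 h12)]
  refine intervalIntegral.norm_integral_le_of_norm_le_const fun y hy => ?_
  rw [uIoc_of_le h12] at hy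
  rw [div_eq_mul_inv, norm_mul, norm_cpow_eq_rpow_re_of_pos hr]
  have e : (a + y * I : ℂ).re = a := by simp
  rw [e]
  gcongr
  exact hD y hy.1.le hy.2

theorem IsGoodHeight.mul_rpow_nonneg {K : ℝ → ℝ} {t δ : ℝ} (h : IsGoodHeight K t) (hδ : 0 < δ) :
    0 ≤ K δ * t ^ δ :=
  (norm_nonneg _).trans ((h 0 (by norm_num) (by norm_num)).2 δ hδ)

theorem IsGoodHeight.mul_rpow_le {K : ℝ → ℝ} {t T δ : ℝ} (hδ : 0 < δ)
    (hδ1 : δ ≤ 1) (ht : 0 ≤ t) (hT : 0 ≤ T) (htT : t ≤ 3 * T) : K δ * t ^ δ ≤ 3 * |K δ| * T ^ δ := by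
  have h1 : t ^ δ ≤ 3 * T ^ δ := by
    calc t ^ δ ≤ (3 * T) ^ δ := by gcongr
      _ = 3 ^ δ * T ^ δ := Real.mul_rpow (by norm_num) hT
      _ ≤ 3 ^ (1 : ℝ) * T ^ δ := by gcongr; norm_num
      _ = _ := by rw [Real.rpow_one]
  calc K δ * t ^ δ ≤ |K δ| * t ^ δ := by gcongr; exact le_abs_self _
    _ ≤ |K δ| * (3 * T ^ δ) := by gcongr
    _ = _ := by ring

/-- The zero sum is small when `r` is very far from `1` in terms of the height. -/
theorem exists_norm_zetaZeroSum_le (hRH : RiemannHypothesis) (K : ℝ → ℝ) {δ : ℝ} (hδ : 0 < δ)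
    (hδ1 : δ ≤ 1) :
    ∃ C : ℝ, 0 < C ∧ ∀ T T₁ T₂ r : ℝ, 1 ≤ T → 3 ≤ T₁ → T₁ ≤ T₂ → T₂ ≤ 3 * T →
      (∀ s, riemannZeta s = 0 → T₁ ≤ s.im → deriv riemannZeta s ≠ 0) →
      IsGoodHeight K T₁ → IsGoodHeight K T₂ → 0 < r →
      T ^ (48 : ℝ) ≤ r ∨ r ≤ T ^ (-48 : ℝ) → ‖zetaZeroSum T₁ T₂ r‖ ≤ C * T ^ δ * (1 + r) := by
  obtain ⟨C, hC, hζ⟩ := exists_norm_inv_riemannZeta_quarter_le hRH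
  refine ⟨6 * C * 3 ^ (11 : ℝ) + 12 * |K δ|, by positivity, ?_⟩
  intro T T₁ T₂ r hT h3 h12 h2T hs g1 g2 hr hfar
  have hT0 : 0 < T := by linarith
  have main := norm_zetaZeroSum_sub_le hRH (a := 1 / 4) (b := 3 / 4) (by norm_num) (by norm_num)
    (by norm_num) (by norm_num) hδ hr (by linarith) h12 hs g1 g2
  have hbd : ∀ t, T₁ ≤ t → t ≤ T₂ → C * t ^ (11 : ℝ) ≤ C * (3 ^ (11 : ℝ) * T ^ (11 : ℝ)) := by
    intro t ht1 ht2
    rw [← Real.mul_rpow (by norm_num) hT0.le]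
    have : 0 ≤ t := by linarith
    gcongr; linarith
  have v1 := norm_verticalIntegral_le (a := 1 / 4) hr h12
    (fun t ht1 ht2 => ((hζ t (by linarith)).1.trans (hbd t ht1 ht2)))
  have v2 := norm_verticalIntegral_le (a := 3 / 4) hr h12
    (fun t ht1 ht2 => ((hζ t (by linarith)).2.trans (hbd t ht1 ht2)))
  have k1 : K δ * T₁ ^ δ ≤ _ := IsGoodHeight.mul_rpow_le (K := K) hδ hδ1 (by linarith) hT0.le (by linarith)
  have k2 : K δ * T₂ ^ δ ≤ _ := IsGoodHeight.mul_rpow_le (K := K) hδ hδ1 (by linarith) hT0.le h2T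
  have hTδ : 1 ≤ T ^ δ := Real.one_le_rpow hT hδ.le
  have hsum : r ^ (1 / 4 : ℝ) + r ^ (3 / 4 : ℝ) ≤ 2 * (1 + r) := by
    have a1 := Real.rpow_le_rpow_add_rpow hr (a := 0) (b := 1) (x := 1 / 4) (by constructor <;> norm_num)
    have a2 := Real.rpow_le_rpow_add_rpow hr (a := 0) (b := 1) (x := 3 / 4) (by constructor <;> norm_num)
    rw [Real.rpow_zero, Real.rpow_one] at a1 a2
    linarith
  -- The vertical sides cost `T^{11}` from `1/ζ` and `T` from their length. Both lines lie at
  -- distance `1/4` from the nearer of `σ = 0` and `σ = 1`, so `r` must beat `T^{12}` by its fourth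
  -- root: hence `48 = 4 · 12`.
  have hsum2 : (r ^ (1 / 4 : ℝ) + r ^ (3 / 4 : ℝ)) * (T ^ (11 : ℝ) * T) ≤ 2 * (1 + r) := by
    have e12 : T ^ (11 : ℝ) * T = T ^ (12 : ℝ) := by
      rw [show (12 : ℝ) = 11 + 1 by norm_num, Real.rpow_add hT0, Real.rpow_one]
    rw [e12]
    rcases hfar with hf | hf
    · have hr1 : 1 ≤ r := (Real.one_le_rpow hT (by norm_num)).trans hf
      have a1 : r ^ (1 / 4 : ℝ) ≤ r ^ (3 / 4 : ℝ) := Real.rpow_le_rpow_of_exponent_le hr1 (by norm_num)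
      have a2 : T ^ (12 : ℝ) ≤ r ^ (1 / 4 : ℝ) := by
        calc T ^ (12 : ℝ) = (T ^ (48 : ℝ)) ^ (1 / 4 : ℝ) := by rw [← Real.rpow_mul hT0.le]; norm_num
          _ ≤ _ := by gcongr
      calc _ ≤ (2 * r ^ (3 / 4 : ℝ)) * r ^ (1 / 4 : ℝ) := by gcongr; linarith
        _ = 2 * r := by rw [mul_assoc, ← Real.rpow_add hr]; norm_num
        _ ≤ _ := by linarith
    · have hr1 : r ≤ 1 := hf.trans (Real.rpow_le_one_of_one_le_of_nonpos hT (by norm_num))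
      have a1 : r ^ (3 / 4 : ℝ) ≤ r ^ (1 / 4 : ℝ) := Real.rpow_le_rpow_of_exponent_ge hr hr1 (by norm_num)
      have a2 : r ^ (1 / 4 : ℝ) ≤ T ^ (-12 : ℝ) := by
        calc r ^ (1 / 4 : ℝ) ≤ (T ^ (-48 : ℝ)) ^ (1 / 4 : ℝ) := by gcongr
          _ = _ := by rw [← Real.rpow_mul hT0.le]; norm_num
      calc _ ≤ (2 * T ^ (-12 : ℝ)) * T ^ (12 : ℝ) := by gcongr; linarith
        _ = 2 := by rw [mul_assoc, ← Real.rpow_add hT0]; norm_num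
        _ ≤ _ := by linarith
  have hπ : ‖zetaZeroSum T₁ T₂ r‖ ≤ ‖2 * Real.pi * zetaZeroSum T₁ T₂ r‖ := by
    rw [norm_mul]
    apply le_mul_of_one_le_left (norm_nonneg _)
    rw [norm_mul, Complex.norm_real, Real.norm_of_nonneg Real.pi_pos.le]
    simp only [norm_ofNat]
    linarith [Real.pi_gt_three]
  have tri : ‖2 * Real.pi * zetaZeroSum T₁ T₂ r‖ ≤ ‖2 * Real.pi * zetaZeroSum T₁ T₂ r -
      (verticalIntegral T₁ T₂ (3 / 4) r - verticalIntegral T₁ T₂ (1 / 4) r)‖ +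
      (‖verticalIntegral T₁ T₂ (3 / 4) r‖ + ‖verticalIntegral T₁ T₂ (1 / 4) r‖) := by
    refine (le_trans (le_of_eq ?_) (norm_add_le _ _)).trans (add_le_add le_rfl (norm_sub_le _ _))
    congr 1; ring
  have p1 : ‖verticalIntegral T₁ T₂ (3 / 4) r‖ + ‖verticalIntegral T₁ T₂ (1 / 4) r‖ ≤
      6 * C * 3 ^ (11 : ℝ) * T ^ δ * (1 + r) := by
    have q : T₂ - T₁ ≤ 3 * T := by linarith
    have hD : 0 ≤ C * (3 ^ (11 : ℝ) * T ^ (11 : ℝ)) := by positivity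
    calc _ ≤ (r ^ (1 / 4 : ℝ) + r ^ (3 / 4 : ℝ)) * (C * (3 ^ (11 : ℝ) * T ^ (11 : ℝ))) * (T₂ - T₁) := by
          linarith
      _ ≤ (r ^ (1 / 4 : ℝ) + r ^ (3 / 4 : ℝ)) * (C * (3 ^ (11 : ℝ) * T ^ (11 : ℝ))) * (3 * T) := by gcongr
      _ = 3 * C * 3 ^ (11 : ℝ) * ((r ^ (1 / 4 : ℝ) + r ^ (3 / 4 : ℝ)) * (T ^ (11 : ℝ) * T)) := by ring
      _ ≤ 3 * C * 3 ^ (11 : ℝ) * (2 * (1 + r)) := by gcongr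
      _ = 6 * C * 3 ^ (11 : ℝ) * 1 * (1 + r) := by ring
      _ ≤ _ := by gcongr
  have p2 : (r ^ (1 / 4 : ℝ) + r ^ (3 / 4 : ℝ)) * (K δ * T₁ ^ δ + K δ * T₂ ^ δ) * (3 / 4 - 1 / 4) ≤
      12 * |K δ| * T ^ δ * (1 + r) := by
    calc _ ≤ (2 * (1 + r)) * (3 * |K δ| * T ^ δ + 3 * |K δ| * T ^ δ) * 1 := by
          have := add_nonneg (g1.mul_rpow_nonneg hδ) (g2.mul_rpow_nonneg hδ)
          gcongr
          norm_num
      _ = _ := by ring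
  calc _ ≤ _ := hπ.trans tri
    _ ≤ 12 * |K δ| * T ^ δ * (1 + r) + 6 * C * 3 ^ (11 : ℝ) * T ^ δ * (1 + r) := by
        exact add_le_add (main.trans p2) p1
    _ = _ := by ring

/-! ### The right side: Möbius expansion and oscillatory integrals. -/

theorem ofReal_cpow_add_mul_I {u : ℝ} (hu : 0 < u) (c y : ℝ) :
    (u : ℂ) ^ (c + y * I : ℂ) = (u ^ c : ℝ) * exp ((Real.log u * I : ℂ) * y) := by
  rw [cpow_add _ _ (by exact_mod_cast hu.ne'), ← ofReal_cpow hu.le,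
    cpow_def_of_ne_zero (x := (u : ℂ)) (by exact_mod_cast hu.ne'), ← ofReal_log hu.le]
  congr 2; ring

theorem norm_integral_cpow_le {u : ℝ} (hu : 0 < u) (c : ℝ) {T₁ T₂ : ℝ} (h12 : T₁ ≤ T₂) :
    ‖∫ y in T₁..T₂, (u : ℂ) ^ (c + y * I : ℂ)‖ ≤ u ^ c * (T₂ - T₁) := by
  rw [← abs_of_nonneg (sub_nonneg.2 h12)]
  refine intervalIntegral.norm_integral_le_of_norm_le_const fun y _ => ?_
  rw [norm_cpow_eq_rpow_re_of_pos hu]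
  simp

theorem norm_integral_cpow_le_div_log {u : ℝ} (hu : 0 < u) (hu1 : u ≠ 1) (c T₁ T₂ : ℝ) :
    ‖∫ y in T₁..T₂, (u : ℂ) ^ (c + y * I : ℂ)‖ ≤ u ^ c * (2 / |Real.log u|) := by
  have hlog : Real.log u ≠ 0 := Real.log_ne_zero_of_pos_of_ne_one hu hu1
  have hne : (Real.log u * I : ℂ) ≠ 0 := mul_ne_zero (by exact_mod_cast hlog) I_ne_zero
  simp only [ofReal_cpow_add_mul_I hu]
  rw [intervalIntegral.integral_const_mul, integral_exp_mul_complex hne, norm_mul, norm_div, Complex.norm_real,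
    Real.norm_of_nonneg (Real.rpow_nonneg hu.le _)]
  have e1 : ‖(Real.log u * I : ℂ)‖ = |Real.log u| := by simp
  have e2 : ∀ T : ℝ, ‖exp ((Real.log u * I : ℂ) * T)‖ = 1 := by
    intro T
    rw [show (Real.log u * I : ℂ) * T = ((Real.log u * T : ℝ) : ℂ) * I by push_cast; ring, norm_exp_ofReal_mul_I]
  rw [e1]
  gcongr
  refine (norm_sub_le _ _).trans ?_
  rw [e2, e2]; norm_num

theorem Real.sub_div_le_abs_log_div {k v : ℝ} (hk : 0 < k) (hv : 0 < v) (hvk : v ≤ 2 * k) :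
    |k - v| / (2 * k) ≤ |Real.log (k / v)| := by
  rw [div_le_iff₀ (by positivity)]
  rcases le_total v k with h | h
  · have h1 := Real.one_sub_inv_le_log_of_pos (div_pos hk hv)
    rw [inv_div] at h1
    have h2 : (1 - v / k) * k = k - v := by field_simp
    rw [abs_of_nonneg (by linarith)]
    calc k - v = (1 - v / k) * k := h2.symm
      _ ≤ |Real.log (k / v)| * k := by gcongr; exact h1.trans (le_abs_self _)
      _ ≤ |Real.log (k / v)| * (2 * k) := by gcongr; linarith
  · have h1 := Real.one_sub_inv_le_log_of_pos (div_pos hv hk)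
    rw [inv_div] at h1
    have h2 : (1 - k / v) * v = v - k := by field_simp
    rw [abs_of_nonpos (by linarith)]
    calc -(k - v) = (1 - k / v) * v := by rw [h2]; ring
      _ ≤ |Real.log (k / v)| * v := by
        gcongr; refine h1.trans ?_; rw [← inv_div k v, Real.log_inv]; exact neg_le_abs _
      _ ≤ |Real.log (k / v)| * (2 * k) := by gcongr

theorem norm_integral_cpow_le_four {k v : ℝ} (hk : 0 < k) (hv : 0 < v) (h : 2 * v ≤ k ∨ 2 * k ≤ v)
    (c T₁ T₂ : ℝ) :
    ‖∫ y in T₁..T₂, ((k / v : ℝ) : ℂ) ^ (c + y * I : ℂ)‖ ≤ 4 * (k / v) ^ c := by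
  have hl2 : (1 / 2 : ℝ) ≤ Real.log 2 := by linarith [Real.log_two_gt_d9]
  have hlog : 1 / 2 ≤ |Real.log (k / v)| := by
    rcases h with h | h
    · refine le_trans (hl2.trans (Real.log_le_log two_pos ?_)) (le_abs_self _)
      rwa [le_div_iff₀ hv]
    · refine le_trans (hl2.trans ?_) (neg_le_abs _)
      rw [← Real.log_inv, inv_div]
      refine Real.log_le_log two_pos ?_
      rwa [le_div_iff₀ hk]
  have hne : k / v ≠ 1 := by
    intro h0; rw [h0] at hlog; norm_num at hlog
  refine (norm_integral_cpow_le_div_log (div_pos hk hv) hne c T₁ T₂).trans ?_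
  rw [mul_comm (4 : ℝ)]
  gcongr
  rw [div_le_iff₀ (by linarith)]
  linarith

/-- Interpolates, as `N = N^δ N^{1-δ}`, between the trivial bound `12 T` and the bound `16 k/|k -
v|` from oscillation. Exponent `1` would later produce a factor `log M`, which no power of `T`
controls; the cost of avoiding it is `T^δ`. -/
theorem norm_integral_cpow_le_rpow {k v T δ : ℝ} (hk : 0 < k) (hv : 0 < v) (hkv : k < 2 * v)
    (hvk : v < 2 * k) (hne : k ≠ v) (hδ : 0 < δ) (hδ1 : δ ≤ 1) {T₁ T₂ : ℝ} (h12 : T₁ ≤ T₂)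
    (hT : T₂ - T₁ ≤ 3 * T) (hT0 : 0 < T) :
    ‖∫ y in T₁..T₂, ((k / v : ℝ) : ℂ) ^ ((1 + δ : ℝ) + y * I : ℂ)‖ ≤
      48 * T ^ δ * (k / |k - v|) ^ (1 - δ) := by
  have hu : 0 < k / v := div_pos hk hv
  have hu1 : k / v ≠ 1 := by rw [Ne, div_eq_one_iff_eq hv.ne']; exact hne
  have hd : 0 < |k - v| := abs_pos.2 (sub_ne_zero.2 hne)
  have h1 := norm_integral_cpow_le hu (1 + δ) h12
  have h2 := norm_integral_cpow_le_div_log hu hu1 (1 + δ) T₁ T₂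
  have hlog := Real.sub_div_le_abs_log_div hk hv hvk.le
  have h2' : 2 / |Real.log (k / v)| ≤ 4 * (k / |k - v|) := by
    calc 2 / |Real.log (k / v)| ≤ 2 / (|k - v| / (2 * k)) := by
          gcongr
      _ = _ := by field_simp; norm_num
  have huc : (k / v) ^ (1 + δ) ≤ 4 := by
    calc (k / v) ^ (1 + δ) ≤ 2 ^ (1 + δ) := by
          gcongr; rw [div_le_iff₀ hv]; linarith
      _ ≤ 2 ^ (2 : ℝ) := Real.rpow_le_rpow_of_exponent_le (by norm_num) (by linarith)
      _ = 4 := by norm_num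
  set N := ‖∫ y in T₁..T₂, ((k / v : ℝ) : ℂ) ^ ((1 + δ : ℝ) + y * I : ℂ)‖
  have hN : 0 ≤ N := norm_nonneg _
  have b1 : N ≤ 12 * T := h1.trans (by
    calc _ ≤ 4 * (3 * T) := by gcongr
      _ = _ := by ring)
  have b2 : N ≤ 16 * (k / |k - v|) := h2.trans (by
    calc _ ≤ 4 * (4 * (k / |k - v|)) := by gcongr
      _ = _ := by ring)
  have hq : 0 ≤ k / |k - v| := by positivity
  have e : N = N ^ δ * N ^ (1 - δ) := by
    rcases hN.eq_or_lt with h | h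
    · rw [← h, Real.zero_rpow hδ.ne', zero_mul]
    · rw [← Real.rpow_add h]; simp
  rw [e]
  calc N ^ δ * N ^ (1 - δ) ≤ (12 * T) ^ δ * (16 * (k / |k - v|)) ^ (1 - δ) := by
        have : 0 ≤ 1 - δ := by linarith
        gcongr
    _ = (12 ^ δ * 16 ^ (1 - δ)) * (T ^ δ * (k / |k - v|) ^ (1 - δ)) := by
        rw [Real.mul_rpow (by norm_num) hT0.le, Real.mul_rpow (by norm_num) hq]; ring
    _ ≤ (16 ^ δ * 16 ^ (1 - δ)) * (T ^ δ * (k / |k - v|) ^ (1 - δ)) := by gcongr; norm_num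
    _ = 16 * (T ^ δ * (k / |k - v|) ^ (1 - δ)) := by rw [← Real.rpow_add (by norm_num)]; norm_num
    _ ≤ 48 * (T ^ δ * (k / |k - v|) ^ (1 - δ)) := by gcongr; norm_num
    _ = _ := by ring

theorem hasSum_moebius_mul_cpow {r : ℝ} (hr : 0 < r) {s : ℂ} (hs : 1 < s.re) :
    HasSum (fun n : ℕ => if n = 0 then 0 else (ArithmeticFunction.moebius n : ℂ) * ((r / n : ℝ) : ℂ) ^ s)
      ((r : ℂ) ^ s / riemannZeta s) := by
  have h1 := ArithmeticFunction.LSeries_zeta_mul_Lseries_moebius hs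
  rw [ArithmeticFunction.LSeries_zeta_eq_riemannZeta hs] at h1
  have h2 := (ArithmeticFunction.LSeriesSummable_moebius_iff.2 hs).LSeriesHasSum.mul_left ((r : ℂ) ^ s)
  rw [eq_inv_of_mul_eq_one_right h1, ← div_eq_mul_inv] at h2
  refine h2.congr_fun fun n => ?_
  by_cases hn : n = 0
  · simp [hn]
  · rw [if_neg hn, LSeries.term_of_ne_zero hn, ofReal_div, ofReal_natCast]
    have := div_cpow_ofReal_nonneg hr.le (Nat.cast_nonneg (α := ℝ) n) s
    rw [ofReal_natCast] at this
    rw [this]; ring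

theorem hasSum_integral_moebius_mul_cpow {r c : ℝ} (hr : 0 < r) (hc : 1 < c) (T₁ T₂ : ℝ) :
    HasSum (fun n : ℕ => if n = 0 then 0 else (ArithmeticFunction.moebius n : ℂ) *
      ∫ y in T₁..T₂, ((r / n : ℝ) : ℂ) ^ (c + y * I : ℂ)) (verticalIntegral T₁ T₂ c r) := by
  have hsumm : Summable fun n : ℕ => r ^ c * (n : ℝ) ^ (-c) :=
    (Real.summable_nat_rpow.2 (by linarith)).mul_left _
  have key := intervalIntegral.hasSum_integral_of_dominated_convergence (μ := volume) (a := T₁) (b := T₂)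
    (F := fun (n : ℕ) (y : ℝ) => if n = 0 then 0 else
      (ArithmeticFunction.moebius n : ℂ) * ((r / n : ℝ) : ℂ) ^ (c + y * I : ℂ))
    (f := fun y : ℝ => (r : ℂ) ^ (c + y * I : ℂ) / riemannZeta (c + y * I))
    (fun n _ => r ^ c * (n : ℝ) ^ (-c)) ?_ ?_ ?_ ?_ ?_
  · refine key.congr_fun fun n => ?_
    by_cases hn : n = 0
    · simp [hn]
    · simp only [hn, if_false]
      rw [intervalIntegral.integral_const_mul]
  · intro n
    by_cases hn : n = 0
    · simp only [hn, if_true]; exact aestronglyMeasurable_const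
    · simp only [hn, if_false]
      have : 0 < r / n := div_pos hr (by positivity)
      apply Continuous.aestronglyMeasurable
      simp only [ofReal_cpow_add_mul_I this]
      fun_prop
  · intro n
    refine Eventually.of_forall fun y _ => ?_
    by_cases hn : n = 0
    · simp only [hn, if_true, norm_zero]; positivity
    · simp only [hn, if_false]
      have hn0 : (0 : ℝ) < n := by positivity
      have : 0 < r / n := div_pos hr hn0
      rw [norm_mul, norm_cpow_eq_rpow_re_of_pos this]
      have e : (c + y * I : ℂ).re = c := by simp
      have hμ : ‖(ArithmeticFunction.moebius n : ℂ)‖ ≤ 1 := by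
        rw [Complex.norm_intCast]
        exact_mod_cast ArithmeticFunction.abs_moebius_le_one
      rw [e, Real.div_rpow hr.le hn0.le, Real.rpow_neg hn0.le, ← div_eq_mul_inv]
      exact mul_le_of_le_one_left (by positivity) hμ
  · exact Eventually.of_forall fun y _ => hsumm
  · exact intervalIntegrable_const
  · exact Eventually.of_forall fun y _ => hasSum_moebius_mul_cpow hr (by simpa)

/-- The coefficient of the diagonal contribution of a pair `(h, k)`: it is `μ(k / h)` when `h ∣ k`. -/
noncomputable def diagonalCoeff (h k : ℕ) : ℝ :=
  if h ∣ k then (ArithmeticFunction.moebius (k / h) : ℝ) else 0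

/-- The near-diagonal sum controlling the oscillatory terms on the line `σ = 1 + δ`. -/
noncomputable def offDiagonalSum (δ : ℝ) (h k : ℕ) : ℝ :=
  ∑ n ∈ Finset.Icc 1 (2 * k) with n * h ≠ k ∧ n * h < 2 * k,
    ((k : ℝ) / |(k : ℝ) - (n * h : ℕ)|) ^ (1 - δ)

/-- Compared term by term in `n`: the terms with `nh = k` cancel, those with `nh` at least a factor
2 away from `k` have frequency bounded below and are summed by `∑ n^{-1-δ}`, and the near ones go
into `offDiagonalSum`. -/
theorem norm_verticalIntegral_sub_le {δ T T₁ T₂ : ℝ} (hδ : 0 < δ) (hδ1 : δ ≤ 1) (h12 : T₁ ≤ T₂)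
    (hT : T₂ - T₁ ≤ 3 * T) (hT0 : 0 < T) {h k : ℕ} (hh : 0 < h) (hk : 0 < k) :
    ‖verticalIntegral T₁ T₂ (1 + δ) ((k : ℝ) / h) - (((T₂ - T₁) * diagonalCoeff h k : ℝ) : ℂ)‖ ≤
      4 * ((k : ℝ) / h) ^ (1 + δ) * (∑' n : ℕ, (n : ℝ) ^ (-(1 + δ))) +
        48 * T ^ δ * offDiagonalSum δ h k := by
  have hh' : (0 : ℝ) < h := by exact_mod_cast hh
  have hk' : (0 : ℝ) < k := by exact_mod_cast hk
  have hr : (0 : ℝ) < (k : ℝ) / h := div_pos hk' hh'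
  have s1 := hasSum_integral_moebius_mul_cpow hr (by linarith : 1 < 1 + δ) T₁ T₂
  have s2 : HasSum (fun n : ℕ => if n * h = k then
      (((T₂ - T₁) * (ArithmeticFunction.moebius n : ℝ) : ℝ) : ℂ) else 0)
      ((((T₂ - T₁) * diagonalCoeff h k : ℝ) : ℂ)) := by
    by_cases hd : h ∣ k
    · have := hasSum_single (f := fun n : ℕ => if n * h = k then
        (((T₂ - T₁) * (ArithmeticFunction.moebius n : ℝ) : ℝ) : ℂ) else 0) (k / h) ?_
      · rw [if_pos (Nat.div_mul_cancel hd)] at this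
        simpa [diagonalCoeff, hd] using this
      · intro n hn
        refine if_neg fun e => hn ?_
        rw [← e, Nat.mul_div_cancel _ hh]
    · have e : (fun n : ℕ => if n * h = k then
        (((T₂ - T₁) * (ArithmeticFunction.moebius n : ℝ) : ℝ) : ℂ) else 0) = fun _ => 0 := by
        funext n
        refine if_neg fun e => hd ⟨n, by rw [← e, mul_comm]⟩
      rw [e]
      simp [diagonalCoeff, hd]
  have s3 : HasSum (fun n : ℕ => 4 * ((k : ℝ) / h) ^ (1 + δ) * (n : ℝ) ^ (-(1 + δ)))
      (4 * ((k : ℝ) / h) ^ (1 + δ) * (∑' n : ℕ, (n : ℝ) ^ (-(1 + δ)))) :=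
    (Real.summable_nat_rpow.2 (by linarith)).hasSum.mul_left _
  set Fs : Finset ℕ := (Finset.Icc 1 (2 * k)).filter fun n => n * h ≠ k ∧ n * h < 2 * k with hFs
  have s4 : HasSum (fun n : ℕ => if n ∈ Fs then
      48 * T ^ δ * ((k : ℝ) / |(k : ℝ) - (n * h : ℕ)|) ^ (1 - δ) else 0)
      (48 * T ^ δ * offDiagonalSum δ h k) := by
    have : HasSum (fun n : ℕ => if n ∈ Fs then
        48 * T ^ δ * ((k : ℝ) / |(k : ℝ) - (n * h : ℕ)|) ^ (1 - δ) else 0)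
        (∑ n ∈ Fs, if n ∈ Fs then
          48 * T ^ δ * ((k : ℝ) / |(k : ℝ) - (n * h : ℕ)|) ^ (1 - δ) else 0) :=
      hasSum_sum_of_ne_finset_zero fun n hn => if_neg hn
    rw [Finset.sum_ite_mem, Finset.inter_self, ← Finset.mul_sum] at this
    exact this
  rw [← (s1.sub s2).tsum_eq]
  refine tsum_of_norm_bounded (s3.add s4) fun n => ?_
  rcases Nat.eq_zero_or_pos n with rfl | hn
  · have : ¬ (0 = k) := by omega
    simp only [if_true, zero_mul, if_neg this, sub_zero, norm_zero]
    have h4 : (0 : ℝ) ≤ if 0 ∈ Fs then 48 * T ^ δ * ((k : ℝ) / |(k : ℝ) - ((0 : ℕ) : ℝ)|) ^ (1 - δ) else 0 := by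
      split_ifs <;> positivity
    positivity
  have hn' : (0 : ℝ) < n := by exact_mod_cast hn
  have ediv : (k : ℝ) / h / n = k / ((n * h : ℕ) : ℝ) := by
    push_cast; rw [div_div, mul_comm]
  have hv : (0 : ℝ) < ((n * h : ℕ) : ℝ) := by positivity
  have h3nn : 0 ≤ 4 * ((k : ℝ) / h) ^ (1 + δ) * (n : ℝ) ^ (-(1 + δ)) := by positivity
  have h4nn : (0 : ℝ) ≤ if n ∈ Fs then
      48 * T ^ δ * ((k : ℝ) / |(k : ℝ) - (n * h : ℕ)|) ^ (1 - δ) else 0 := by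
    split_ifs <;> positivity
  rw [if_neg hn.ne', ediv]
  by_cases he : n * h = k
  · rw [if_pos he, he, div_self hk'.ne']
    simp only [ofReal_one, one_cpow, intervalIntegral.integral_const]
    rw [show (ArithmeticFunction.moebius n : ℂ) * ((T₂ - T₁) • (1 : ℂ)) -
      (((T₂ - T₁) * (ArithmeticFunction.moebius n : ℝ) : ℝ) : ℂ) = 0 by
        simp; ring, norm_zero]
    exact add_nonneg h3nn (by rwa [← he] at h4nn ⊢)
  rw [if_neg he, sub_zero, norm_mul]
  have hμ : ‖(ArithmeticFunction.moebius n : ℂ)‖ ≤ 1 := by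
    rw [Complex.norm_intCast]
    exact_mod_cast ArithmeticFunction.abs_moebius_le_one
  refine (mul_le_of_le_one_left (norm_nonneg _) hμ).trans ?_
  by_cases hfar : 2 * ((n * h : ℕ) : ℝ) ≤ k ∨ 2 * (k : ℝ) ≤ ((n * h : ℕ) : ℝ)
  · refine (norm_integral_cpow_le_four hk' hv hfar (1 + δ) T₁ T₂).trans ?_
    refine le_trans (le_of_eq ?_) (le_add_of_nonneg_right h4nn)
    rw [← ediv, Real.div_rpow hr.le hn'.le, Real.rpow_neg hn'.le]; ring
  · push Not at hfar
    have hlt : n * h < 2 * k := by exact_mod_cast hfar.2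
    have hmem : n ∈ Fs := by
      rw [hFs, Finset.mem_filter, Finset.mem_Icc]
      exact ⟨⟨hn, by nlinarith⟩, he, hlt⟩
    refine le_trans ?_ (le_add_of_nonneg_left h3nn)
    rw [if_pos hmem]
    exact norm_integral_cpow_le_rpow hk' hv hfar.1 hfar.2 (by exact_mod_cast (Ne.symm he)) hδ hδ1 h12 hT hT0

/-! ### Summation of the near-diagonal terms. -/

theorem sum_Icc_rpow_neg_le {a : ℝ} (ha : 0 ≤ a) (ha1 : a < 1) (N : ℕ) :
    ∑ n ∈ Finset.Icc 1 N, (n : ℝ) ^ (-a) ≤ (N : ℝ) ^ (1 - a) / (1 - a) := by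
  have h1a : 0 < 1 - a := by linarith
  induction N with
  | zero => simp [Real.zero_rpow h1a.ne']
  | succ N ih =>
    rw [Finset.sum_Icc_succ_top (by omega)]
    have hN : (0 : ℝ) < (N : ℝ) + 1 := by positivity
    -- Bernoulli's inequality for the exponent `1 - a` at `1 - 1/(N + 1)` gives the induction step.
    have hb := rpow_one_add_le_one_add_mul_self (s := -1 / ((N : ℝ) + 1)) (p := 1 - a)
      (by rw [le_div_iff₀ hN]; linarith [N.cast_nonneg (α := ℝ)]) h1a.le (by linarith)
    have e1 : 1 + -1 / ((N : ℝ) + 1) = N / (N + 1) := by field_simp; ring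
    rw [e1, Real.div_rpow N.cast_nonneg hN.le, div_le_iff₀ (by positivity)] at hb
    have e2 : ((N : ℝ) + 1) ^ (1 - a) = ((N : ℝ) + 1) ^ (-a) * (N + 1) := by
      rw [show 1 - a = -a + 1 by ring, Real.rpow_add hN, Real.rpow_one]
    have hb2 : (N : ℝ) ^ (1 - a) ≤ ((N : ℝ) + 1) ^ (1 - a) - (1 - a) * ((N : ℝ) + 1) ^ (-a) := by
      refine hb.trans (le_of_eq ?_)
      rw [e2]; field_simp; ring
    push_cast
    calc _ ≤ (N : ℝ) ^ (1 - a) / (1 - a) + ((N : ℝ) + 1) ^ (-a) := by gcongr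
      _ ≤ _ := by
        rw [div_add' _ _ _ h1a.ne']
        gcongr
        linarith

/-- Each distance to `v` is attained at most twice, once on each side. -/
theorem sum_comp_abs_sub_le {f : ℕ → ℝ} (hf : ∀ d, 0 ≤ f d) {S D : Finset ℕ} (v : ℕ)
    (hD : ∀ k ∈ S, ((k : ℤ) - v).natAbs ∈ D) :
    ∑ k ∈ S, f ((k : ℤ) - v).natAbs ≤ 2 * ∑ d ∈ D, f d := by
  have half : ∀ S' ⊆ S, Set.InjOn (fun k : ℕ => ((k : ℤ) - v).natAbs) S' →
      ∑ k ∈ S', f ((k : ℤ) - v).natAbs ≤ ∑ d ∈ D, f d := by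
    intro S' hS' hinj
    rw [← Finset.sum_image (f := f) (g := fun k : ℕ => ((k : ℤ) - v).natAbs) hinj]
    refine Finset.sum_le_sum_of_subset_of_nonneg ?_ fun d _ _ => hf d
    intro d hd
    obtain ⟨k, hk, rfl⟩ := Finset.mem_image.1 hd
    exact hD k (hS' hk)
  rw [← Finset.sum_filter_add_sum_filter_not S (fun k => k ≤ v), two_mul]
  refine add_le_add (half _ (Finset.filter_subset _ _) ?_) (half _ (Finset.filter_subset _ _) ?_)
  · intro a ha b hb hab
    simp only [Finset.coe_filter, Set.mem_ofPred_eq] at ha hb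
    simp only at hab
    omega
  · intro a ha b hb hab
    simp only [Finset.coe_filter, Set.mem_ofPred_eq] at ha hb
    simp only at hab
    omega

/-- Since `nh < 2k`, the factor `k^{-δ}` is at most `2 (nh)^{-δ}`. The sum over `k` of `|k -
nh|^{δ-1}` is then `≪ N^δ`, the sum of `(nh)^{-δ}` over `n ≤ 2N/h` is `≪ N^{1-δ}/h`, and the powers
of `N` combine without a logarithm. -/
theorem sum_offDiagonalSum_div_le {δ : ℝ} (hδ : 0 < δ) (hδ1 : δ < 1) {N h : ℕ} (hh : 0 < h) :
    ∑ k ∈ Finset.Icc 1 N, offDiagonalSum δ h k / k ≤ 8 / (δ * (1 - δ)) * (N / h) := by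
  have hh' : (0 : ℝ) < h := by exact_mod_cast hh
  have h1δ : 0 < 1 - δ := by linarith
  have step1 : ∀ k ∈ Finset.Icc 1 N, offDiagonalSum δ h k / k ≤
      ∑ n ∈ Finset.Icc 1 (2 * N / h), if n * h ≠ k then
        2 * ((n : ℝ) * h) ^ (-δ) * ((((k : ℤ) - (n * h : ℕ)).natAbs : ℕ) : ℝ) ^ (-(1 - δ)) else 0 := by
    intro k hk
    rw [Finset.mem_Icc] at hk
    have hk' : (0 : ℝ) < k := by exact_mod_cast hk.1
    rw [offDiagonalSum, Finset.sum_div, ← Finset.sum_filter]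
    refine (Finset.sum_le_sum (g := fun n : ℕ => 2 * ((n : ℝ) * h) ^ (-δ) *
      ((((k : ℤ) - (n * h : ℕ)).natAbs : ℕ) : ℝ) ^ (-(1 - δ))) ?_).trans
      (Finset.sum_le_sum_of_subset_of_nonneg ?_ fun _ _ _ => by positivity)
    · intro n hn
      rw [Finset.mem_filter, Finset.mem_Icc] at hn
      have hn' : (0 : ℝ) < n := by exact_mod_cast hn.1.1
      have hd : 0 < ((k : ℤ) - (n * h : ℕ)).natAbs := by
        have := hn.2.1; omega
      have ed : |(k : ℝ) - (n * h : ℕ)| = ((((k : ℤ) - (n * h : ℕ)).natAbs : ℕ) : ℝ) := by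
        rw [Nat.cast_natAbs]; push_cast; rfl
      rw [ed]
      set d : ℕ := ((k : ℤ) - (n * h : ℕ)).natAbs
      have hd' : (0 : ℝ) < d := by exact_mod_cast hd
      have hlt : (n : ℝ) * h < 2 * k := by exact_mod_cast hn.2.2
      have e1 : ((k : ℝ) / d) ^ (1 - δ) / k = (k : ℝ) ^ (-δ) * (d : ℝ) ^ (-(1 - δ)) := by
        rw [Real.div_rpow hk'.le hd'.le, Real.rpow_neg hd'.le, show -δ = (1 - δ) - 1 by ring,
          Real.rpow_sub_one hk'.ne']
        ring
      rw [e1]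
      gcongr
      have h2 : ((2 : ℝ) * k) ^ (-δ) ≤ ((n : ℝ) * h) ^ (-δ) :=
        Real.rpow_le_rpow_of_nonpos (by positivity) hlt.le (by linarith)
      rw [Real.mul_rpow (by norm_num) hk'.le] at h2
      have h3 : (1 / 2 : ℝ) ≤ 2 ^ (-δ) := by
        calc (1 / 2 : ℝ) = 2 ^ (-1 : ℝ) := by rw [Real.rpow_neg_one]; norm_num
          _ ≤ _ := Real.rpow_le_rpow_of_exponent_le (by norm_num) (by linarith)
      have h4 : (1 / 2 : ℝ) * (k : ℝ) ^ (-δ) ≤ 2 ^ (-δ) * (k : ℝ) ^ (-δ) := by gcongr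
      linarith
    · intro n hn
      rw [Finset.mem_filter, Finset.mem_Icc] at hn ⊢
      refine ⟨⟨hn.1.1, ?_⟩, hn.2.1⟩
      rw [Nat.le_div_iff_mul_le hh]
      omega
  refine (Finset.sum_le_sum step1).trans ?_
  rw [Finset.sum_comm]
  have step2 : ∀ n ∈ Finset.Icc 1 (2 * N / h), (∑ k ∈ Finset.Icc 1 N, if n * h ≠ k then
        2 * ((n : ℝ) * h) ^ (-δ) * ((((k : ℤ) - (n * h : ℕ)).natAbs : ℕ) : ℝ) ^ (-(1 - δ)) else 0) ≤
      2 * ((n : ℝ) * h) ^ (-δ) * (2 * ((2 * N : ℕ) ^ δ / δ)) := by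
    intro n hn
    rw [Finset.mem_Icc, Nat.le_div_iff_mul_le hh] at hn
    rw [← Finset.sum_filter, ← Finset.mul_sum]
    gcongr
    refine (sum_comp_abs_sub_le (f := fun d : ℕ => (d : ℝ) ^ (-(1 - δ))) (fun d => by positivity)
      (D := Finset.Icc 1 (2 * N)) (n * h) ?_).trans ?_
    · intro k hk
      rw [Finset.mem_filter, Finset.mem_Icc] at hk
      rw [Finset.mem_Icc]
      have := hk.2
      omega
    · have := sum_Icc_rpow_neg_le (a := 1 - δ) h1δ.le (by linarith) (2 * N)
      rw [sub_sub_cancel] at this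
      gcongr
  refine (Finset.sum_le_sum step2).trans ?_
  rw [← Finset.sum_mul, ← Finset.mul_sum]
  have step3 : ∑ n ∈ Finset.Icc 1 (2 * N / h), ((n : ℝ) * h) ^ (-δ) ≤
      (h : ℝ) ^ (-δ) * ((2 * N / h : ℝ) ^ (1 - δ) / (1 - δ)) := by
    calc _ = (h : ℝ) ^ (-δ) * ∑ n ∈ Finset.Icc 1 (2 * N / h), (n : ℝ) ^ (-δ) := by
          rw [Finset.mul_sum]
          refine Finset.sum_congr rfl fun n _ => ?_
          rw [Real.mul_rpow n.cast_nonneg hh'.le, mul_comm]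
      _ ≤ (h : ℝ) ^ (-δ) * (((2 * N / h : ℕ) : ℝ) ^ (1 - δ) / (1 - δ)) := by
          gcongr; exact sum_Icc_rpow_neg_le hδ.le hδ1 _
      _ ≤ _ := by
          gcongr
          have := Nat.cast_div_le (α := ℝ) (m := 2 * N) (n := h)
          push_cast at this ⊢
          exact this
  calc _ ≤ 2 * ((h : ℝ) ^ (-δ) * ((2 * N / h : ℝ) ^ (1 - δ) / (1 - δ))) * (2 * ((2 * N : ℕ) ^ δ / δ)) := by
        gcongr
    _ = 4 / (δ * (1 - δ)) * ((h : ℝ) ^ (-δ) * ((2 * N / h : ℝ) ^ (1 - δ) * (2 * N : ℝ) ^ δ)) := by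
        push_cast; field_simp; ring
    _ = 8 / (δ * (1 - δ)) * (N / h) := by
        rcases Nat.eq_zero_or_pos N with rfl | hN
        · simp [Real.zero_rpow hδ.ne']
        have h2N : (0 : ℝ) < 2 * N := by positivity
        have e1 : (h : ℝ) ^ (-δ) * (h : ℝ) ^ (-(1 - δ)) = (h : ℝ)⁻¹ := by
          rw [← Real.rpow_add hh', ← Real.rpow_neg_one]; congr 1; ring
        have e2 : (2 * N : ℝ) ^ (1 - δ) * (2 * N : ℝ) ^ δ = 2 * N := by
          rw [← Real.rpow_add h2N]; simp
        rw [Real.div_rpow h2N.le hh'.le, div_eq_mul_inv _ ((h : ℝ) ^ (1 - δ)), ← Real.rpow_neg hh'.le,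
          show (h : ℝ) ^ (-δ) * ((2 * N : ℝ) ^ (1 - δ) * (h : ℝ) ^ (-(1 - δ)) * (2 * N : ℝ) ^ δ) =
            ((h : ℝ) ^ (-δ) * (h : ℝ) ^ (-(1 - δ))) * ((2 * N : ℝ) ^ (1 - δ) * (2 * N : ℝ) ^ δ) by ring,
          e1, e2]
        ring

/-! ### The left side: mean values of exponential polynomials. -/

/-- From `(y - 1/2)² ≥ 0`, `exp(-y²) ≤ e^{1/4} exp(-y) ≤ 2 exp(-y)`; what remains is a two-sided
geometric series. -/
theorem sum_exp_neg_sq_mul_le {u : ℝ} (hu : 0 < u) (S : Finset ℕ) (m : ℕ) :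
    ∑ n ∈ S, Real.exp (-(u * |(n : ℝ) - m|) ^ 2) ≤ 4 * (1 + 1 / u) := by
  have hq0 : 0 ≤ Real.exp (-u) := (Real.exp_pos _).le
  have hq1 : Real.exp (-u) < 1 := by rw [Real.exp_lt_one_iff]; linarith
  have e : ∀ n : ℕ, Real.exp (-(u * |(n : ℝ) - m|) ^ 2) ≤ 2 * Real.exp (-u) ^ ((n : ℤ) - m).natAbs := by
    intro n
    have ed : |(n : ℝ) - m| = ((((n : ℤ) - m).natAbs : ℕ) : ℝ) := by
      rw [Nat.cast_natAbs]; push_cast; rfl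
    rw [ed, ← Real.exp_nat_mul]
    set d : ℝ := ((((n : ℤ) - m).natAbs : ℕ) : ℝ)
    have h2 : Real.exp (1 / 4) ≤ 2 := by
      rw [← Real.le_log_iff_exp_le two_pos]; linarith [Real.log_two_gt_d9]
    calc _ ≤ Real.exp (1 / 4 + d * -u) := by
          gcongr; nlinarith [sq_nonneg (u * d - 1 / 2)]
      _ = Real.exp (1 / 4) * Real.exp (d * -u) := Real.exp_add _ _
      _ ≤ _ := by gcongr
  refine (Finset.sum_le_sum fun n _ => e n).trans ?_
  rw [← Finset.mul_sum]
  have h1 := sum_comp_abs_sub_le (f := fun d => Real.exp (-u) ^ d) (fun d => by positivity) (S := S)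
    (D := S.image fun k : ℕ => ((k : ℤ) - m).natAbs) m (fun k hk => Finset.mem_image_of_mem _ hk)
  have h2 : ∑ d ∈ S.image (fun k : ℕ => ((k : ℤ) - m).natAbs), Real.exp (-u) ^ d ≤ (1 - Real.exp (-u))⁻¹ := by
    rw [← tsum_geometric_of_lt_one hq0 hq1]
    exact (summable_geometric_of_lt_one hq0 hq1).sum_le_tsum _ fun d _ => by positivity
  have h3 : (1 - Real.exp (-u))⁻¹ ≤ 1 + 1 / u := by
    have : Real.exp (-u) ≤ 1 / (1 + u) := by
      rw [Real.exp_neg, ← one_div]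
      gcongr
      linarith [Real.add_one_le_exp u]
    have h4 : u / (1 + u) ≤ 1 - Real.exp (-u) := by
      have : u / (1 + u) = 1 - 1 / (1 + u) := by field_simp; ring
      linarith
    calc _ ≤ (u / (1 + u))⁻¹ := by gcongr
      _ = _ := by rw [inv_div]; field_simp; ring
  calc _ ≤ 2 * (2 * (1 + 1 / u)) := by gcongr; exact h1.trans (by gcongr; exact h2.trans h3)
    _ = _ := by ring

/-- A mean value theorem for exponential polynomials with separated frequencies. -/
theorem exists_integral_norm_sq_le : ∃ C : ℝ, 0 < C ∧ ∀ (S : Finset ℕ) (b l : ℕ → ℝ)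
    (N T T₁ T₂ : ℝ), 0 < N → 0 < T → 0 ≤ T₁ → T₁ ≤ T₂ → T₂ ≤ 3 * T →
    (∀ m ∈ S, ∀ n ∈ S, |(m : ℝ) - n| / N ≤ |l m - l n|) →
    ∫ y in T₁..T₂, ‖∑ n ∈ S, (b n : ℂ) * exp (I * l n * y)‖ ^ 2 ≤ C * (T + N) * ∑ n ∈ S, b n ^ 2 := by
  refine ⟨Real.exp 9 * 16, by positivity, ?_⟩
  intro S b l N T T₁ T₂ hN hT h1 h12 h2T hsep
  -- The Gaussian `exp(-y²/T²)` is at least `exp(-9)` on `[0, 3T]`, and its Fourier transform makes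
  -- the pair `(m, n)` decay like `exp(-(T (l m - l n)/2)²)`.
  set β : ℝ := 1 / T ^ 2 with hβ
  have hβ0 : 0 < β := by positivity
  set D : ℝ → ℂ := fun y => ∑ n ∈ S, (b n : ℂ) * exp (I * l n * y) with hD
  have hDc : Continuous D := by rw [hD]; fun_prop
  have hexpand : ∀ y : ℝ, ((‖D y‖ ^ 2 * Real.exp (-β * y ^ 2) : ℝ) : ℂ) =
      ∑ m ∈ S, ∑ n ∈ S, (b m * b n : ℂ) * (exp (I * (l m - l n : ℝ) * y) * exp (-β * (y : ℂ) ^ 2)) := by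
    intro y
    have hc : (starRingEnd ℂ) (D y) = ∑ n ∈ S, (b n : ℂ) * exp (-(I * l n * y)) := by
      rw [hD]
      simp only [map_sum, map_mul, conj_ofReal]
      refine Finset.sum_congr rfl fun n _ => ?_
      rw [← exp_conj]
      simp
    have : ((‖D y‖ ^ 2 : ℝ) : ℂ) = D y * (starRingEnd ℂ) (D y) := by
      rw [Complex.mul_conj, Complex.normSq_eq_norm_sq]
    rw [ofReal_mul, this, hc]
    simp only [hD]
    rw [Finset.sum_mul_sum, Finset.sum_mul]
    refine Finset.sum_congr rfl fun m _ => ?_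
    rw [Finset.sum_mul]
    refine Finset.sum_congr rfl fun n _ => ?_
    have : exp (I * (l m - l n : ℝ) * y) = exp (I * l m * y) * exp (-(I * l n * y)) := by
      rw [← exp_add]; congr 1; push_cast; ring
    rw [this]
    push_cast
    ring
  have hgint : ∀ t : ℝ, Integrable fun y : ℝ => exp (I * t * y) * exp (-β * (y : ℂ) ^ 2) := by
    intro t
    have hb : 0 < (β : ℂ).re := by simpa
    have := integrable_cexp_quadratic' (b := -β) (by simpa) (I * t) 0
    refine this.congr (Eventually.of_forall fun y => ?_)
    simp only
    rw [← exp_add]; congr 1; ring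
  have hint : Integrable fun y : ℝ => ‖D y‖ ^ 2 * Real.exp (-β * y ^ 2) := by
    have : Integrable fun y : ℝ => ((‖D y‖ ^ 2 * Real.exp (-β * y ^ 2) : ℝ) : ℂ) := by
      simp only [hexpand]
      exact integrable_finsetSum _ fun m _ => integrable_finsetSum _ fun n _ => (hgint _).const_mul _
    exact_mod_cast this.re
  have hgauss : ∀ t : ℝ, ‖∫ y : ℝ, exp (I * t * y) * exp (-β * (y : ℂ) ^ 2)‖ ≤
      2 * T * Real.exp (-(T * t / 2) ^ 2) := by
    intro t
    rw [fourierIntegral_gaussian (by simpa : 0 < (β : ℂ).re) (t : ℂ), norm_mul]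
    have e1 : ‖((Real.pi : ℂ) / β) ^ (1 / 2 : ℂ)‖ ≤ 2 * T := by
      rw [show ((Real.pi : ℂ) / β) = ((Real.pi / β : ℝ) : ℂ) by push_cast; rfl,
        norm_cpow_eq_rpow_re_of_pos (div_pos Real.pi_pos hβ0)]
      have : (1 / 2 : ℂ).re = 1 / 2 := by norm_num
      rw [this, ← Real.sqrt_eq_rpow]
      refine Real.sqrt_le_iff.2 ⟨by positivity, ?_⟩
      rw [hβ]
      field_simp
      linarith [Real.pi_le_four]
    have e2 : ‖exp (-(t : ℂ) ^ 2 / (4 * β))‖ = Real.exp (-(T * t / 2) ^ 2) := by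
      rw [show (-(t : ℂ) ^ 2 / (4 * β)) = ((-(T * t / 2) ^ 2 : ℝ) : ℂ) by
        rw [hβ]; push_cast; field_simp; ring, norm_exp, ofReal_re]
    rw [e2]
    gcongr
  have hnorm : ∫ y : ℝ, ‖D y‖ ^ 2 * Real.exp (-β * y ^ 2) ≤
      ∑ m ∈ S, ∑ n ∈ S, |b m * b n| * (2 * T * Real.exp (-(T * (l m - l n) / 2) ^ 2)) := by
    have e : ((∫ y : ℝ, ‖D y‖ ^ 2 * Real.exp (-β * y ^ 2) : ℝ) : ℂ) =
        ∑ m ∈ S, ∑ n ∈ S, (b m * b n : ℂ) *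
          ∫ y : ℝ, exp (I * (l m - l n : ℝ) * y) * exp (-β * (y : ℂ) ^ 2) := by
      rw [← integral_complex_ofReal]
      simp only [hexpand]
      rw [integral_finsetSum _ fun m _ => integrable_finsetSum _ fun n _ => (hgint _).const_mul _]
      refine Finset.sum_congr rfl fun m _ => ?_
      rw [integral_finsetSum _ fun n _ => (hgint _).const_mul _]
      refine Finset.sum_congr rfl fun n _ => ?_
      exact MeasureTheory.integral_const_mul _ _
    refine (le_abs_self _).trans ?_
    rw [← Real.norm_eq_abs, ← Complex.norm_real, e]
    refine (norm_sum_le _ _).trans (Finset.sum_le_sum fun m _ => (norm_sum_le _ _).trans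
      (Finset.sum_le_sum fun n _ => ?_))
    rw [norm_mul, ← ofReal_mul, Complex.norm_real, Real.norm_eq_abs]
    gcongr
    exact hgauss _
  have hrow : ∀ m ∈ S, ∑ n ∈ S, Real.exp (-(T * (l m - l n) / 2) ^ 2) ≤ 4 * (1 + 2 * N / T) := by
    intro m hm
    have := sum_exp_neg_sq_mul_le (u := T / (2 * N)) (by positivity) S m
    rw [one_div_div] at this
    refine le_trans (Finset.sum_le_sum fun n hn => ?_) this
    have h := hsep n hn m hm
    gcongr Real.exp (-?_)
    rw [← sq_abs (T * (l m - l n) / 2), abs_div, abs_mul, abs_of_pos hT, abs_sub_comm (l m)]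
    gcongr
    rw [abs_two]
    calc T / (2 * N) * |(n : ℝ) - m| = T * (|(n : ℝ) - m| / N) / 2 := by field_simp
      _ ≤ _ := by gcongr
  -- Schur's test: `2 |b m b n| ≤ b m² + b n²` with symmetry of the kernel reduces the double sum to
  -- the row sums.
  have hdouble : ∑ m ∈ S, ∑ n ∈ S, |b m * b n| * (2 * T * Real.exp (-(T * (l m - l n) / 2) ^ 2)) ≤
      16 * (T + N) * ∑ n ∈ S, b n ^ 2 := by
    set w : ℕ → ℕ → ℝ := fun m n => Real.exp (-(T * (l m - l n) / 2) ^ 2) with hw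
    have hsym : ∀ m n, w m n = w n m := by
      intro m n; simp only [hw]; congr 1; ring
    have hw0 : ∀ m n, 0 ≤ w m n := fun m n => (Real.exp_pos _).le
    have e1 : ∑ m ∈ S, ∑ n ∈ S, |b m * b n| * (2 * T * w m n) ≤
        ∑ m ∈ S, ∑ n ∈ S, (T * b m ^ 2 * w m n + T * b n ^ 2 * w m n) := by
      refine Finset.sum_le_sum fun m _ => Finset.sum_le_sum fun n _ => ?_
      have h : 2 * |b m * b n| ≤ b m ^ 2 + b n ^ 2 := by
        rw [abs_mul, ← sq_abs (b m), ← sq_abs (b n)]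
        nlinarith [sq_nonneg (|b m| - |b n|)]
      have := mul_le_mul_of_nonneg_right h (mul_nonneg hT.le (hw0 m n))
      linarith
    refine e1.trans ?_
    simp only [Finset.sum_add_distrib]
    rw [Finset.sum_comm (f := fun m n => T * b n ^ 2 * w m n)]
    have e2 : ∑ m ∈ S, ∑ n ∈ S, T * b m ^ 2 * w n m = ∑ m ∈ S, ∑ n ∈ S, T * b m ^ 2 * w m n :=
      Finset.sum_congr rfl fun m _ => Finset.sum_congr rfl fun n _ => by rw [hsym]
    rw [e2, ← two_mul, Finset.mul_sum, Finset.mul_sum]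
    refine Finset.sum_le_sum fun m hm => ?_
    rw [← Finset.mul_sum]
    have hT' : T * (4 * (1 + 2 * N / T)) = 4 * T + 8 * N := by field_simp; ring
    calc 2 * (T * b m ^ 2 * ∑ n ∈ S, w m n) ≤ 2 * (T * b m ^ 2 * (4 * (1 + 2 * N / T))) := by
          gcongr; exact hrow m hm
      _ = 2 * b m ^ 2 * (T * (4 * (1 + 2 * N / T))) := by ring
      _ ≤ 2 * b m ^ 2 * (8 * (T + N)) := by rw [hT']; gcongr; linarith
      _ = _ := by ring
  have hle : ∫ y in T₁..T₂, ‖D y‖ ^ 2 ≤ Real.exp 9 * ∫ y : ℝ, ‖D y‖ ^ 2 * Real.exp (-β * y ^ 2) := by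
    rw [← MeasureTheory.integral_const_mul, intervalIntegral.integral_of_le h12]
    refine le_trans (setIntegral_mono_on ?_ (hint.const_mul _).integrableOn measurableSet_Ioc ?_)
      (setIntegral_le_integral (hint.const_mul _) (Eventually.of_forall fun y => ?_))
    · exact ((hDc.norm.pow 2).integrableOn_Icc).mono_set Ioc_subset_Icc_self
    · intro y hy
      have hy2 : β * y ^ 2 ≤ 9 := by
        have h0 : 0 ≤ y := by linarith [hy.1]
        rw [hβ, one_div_mul_eq_div, div_le_iff₀ (by positivity)]
        nlinarith [hy.2]
      have : 1 ≤ Real.exp 9 * Real.exp (-β * y ^ 2) := by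
        rw [← Real.exp_add]; apply Real.one_le_exp; linarith
      nlinarith [sq_nonneg ‖D y‖]
    · simp only [Pi.zero_apply]; positivity
  calc _ ≤ _ := hle
    _ ≤ Real.exp 9 * (16 * (T + N) * ∑ n ∈ S, b n ^ 2) := by gcongr; exact hnorm.trans hdouble
    _ = _ := by ring

theorem intervalIntegral_le_sqrt_mul {f : ℝ → ℝ} (hf : Continuous f) {a b L Q : ℝ}
    (hab : a ≤ b) (hL : b - a ≤ L) (hQ : ∫ y in a..b, f y ^ 2 ≤ Q) :
    ∫ y in a..b, f y ≤ Real.sqrt (L * Q) := by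
  apply Real.le_sqrt_of_sq_le
  have hQ0 : 0 ≤ ∫ y in a..b, f y ^ 2 := intervalIntegral.integral_nonneg hab fun y _ => sq_nonneg _
  rcases hab.eq_or_lt with rfl | hlt
  · simp only [intervalIntegral.integral_same] at hQ ⊢
    have : 0 ≤ L := by linarith
    nlinarith
  set P := ∫ y in a..b, f y with hP
  have hl : 0 < b - a := by linarith
  set c := P / (b - a) with hc
  -- Cauchy–Schwarz as nonnegativity of the variance; `c` is the mean of `f`.
  have h0 : 0 ≤ ∫ y in a..b, (f y ^ 2 - 2 * c * f y + c ^ 2) :=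
    intervalIntegral.integral_nonneg hab fun y _ => by nlinarith [sq_nonneg (f y - c)]
  rw [intervalIntegral.integral_add, intervalIntegral.integral_sub, intervalIntegral.integral_const_mul,
    intervalIntegral.integral_const, smul_eq_mul, ← hP] at h0
  · have e : 2 * c * P - (b - a) * c ^ 2 = P ^ 2 / (b - a) := by rw [hc]; field_simp; ring
    have h1 : P ^ 2 / (b - a) ≤ Q := by linarith
    rw [div_le_iff₀ hl] at h1
    have : Q * (b - a) ≤ Q * L := by gcongr; linarith
    linarith
  all_goals exact Continuous.intervalIntegrable (by fun_prop) _ _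

/-- The frequencies `log (k/h)`, `h ≤ N`, are separated by `|m - n| / N`. The factor `T^{-1/2}` from
`1/ζ` cancels the `T^{1/2}` that Cauchy–Schwarz costs on an interval of length at most `3T`. The
subset `S` and the weight bound `q` serve to restrict to near pairs. -/
theorem exists_norm_sum_verticalIntegral_le (hRH : RiemannHypothesis) {δ : ℝ} (hδ : 0 < δ) :
    ∃ C : ℝ, 0 < C ∧ ∀ (S : Finset ℕ) (x : ℕ → ℝ) (N k : ℕ) (T T₁ T₂ q : ℝ), 0 < N → 0 < k →
      S ⊆ Finset.Icc 1 N → 1 ≤ T₁ → T ≤ 2 * T₁ → T₁ ≤ T₂ → T₂ ≤ 3 * T → 0 ≤ q →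
      (∀ h ∈ S, ((k : ℝ) / h) ^ (-δ) ≤ q) →
      ‖∑ h ∈ S, (x h : ℂ) * verticalIntegral T₁ T₂ (-δ) ((k : ℝ) / h)‖ ≤
        C * q * Real.sqrt ((T + N) * ∑ h ∈ Finset.Icc 1 N, x h ^ 2) := by
  obtain ⟨C₁, hC₁, hζ⟩ := exists_norm_inv_riemannZeta_neg_le hδ
  obtain ⟨C₂, hC₂, hmv⟩ := exists_integral_norm_sq_le
  refine ⟨C₁ * Real.sqrt (6 * C₂), by positivity, ?_⟩
  intro S x N k T T₁ T₂ q hN hk hS h1 hT1 h12 h2T hq0 hq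
  have hN' : (0 : ℝ) < N := by exact_mod_cast hN
  have hk' : (0 : ℝ) < k := by exact_mod_cast hk
  have hT : 0 < T := by linarith
  have hpos : ∀ h ∈ S, (0 : ℝ) < h := fun h hh => by
    exact_mod_cast (Finset.mem_Icc.1 (hS hh)).1
  set b : ℕ → ℝ := fun h => x h * ((k : ℝ) / h) ^ (-δ) with hb
  set l : ℕ → ℝ := fun h => Real.log ((k : ℝ) / h) with hl
  set D : ℝ → ℂ := fun y => ∑ h ∈ S, (b h : ℂ) * exp (I * l h * y) with hD
  have hDc : Continuous D := by rw [hD]; fun_prop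
  have hne : ∀ y ∈ Icc T₁ T₂, riemannZeta ((-δ : ℝ) + y * I) ≠ 0 := by
    intro y hy h0
    have := re_eq_half_of_riemannZeta_eq_zero hRH h0 (by simp; linarith [hy.1])
    simp at this
    linarith
  have hζc : ContinuousOn (fun y : ℝ => (riemannZeta ((-δ : ℝ) + y * I))⁻¹) (Icc T₁ T₂) := by
    refine ContinuousOn.inv₀ ?_ hne
    intro y hy
    refine ContinuousAt.continuousWithinAt ?_
    refine ContinuousAt.comp (f := fun y : ℝ => ((-δ : ℝ) + y * I : ℂ)) (g := riemannZeta)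
      (differentiableAt_riemannZeta ?_).continuousAt (by fun_prop)
    intro h
    have := congrArg Complex.re h
    simp at this
    linarith
  have hsum : ∑ h ∈ S, (x h : ℂ) * verticalIntegral T₁ T₂ (-δ) ((k : ℝ) / h) =
      ∫ y in T₁..T₂, D y * (riemannZeta ((-δ : ℝ) + y * I))⁻¹ := by
    simp only [hD, Finset.sum_mul]
    rw [intervalIntegral.integral_finsetSum]
    · refine Finset.sum_congr rfl fun h hh => ?_
      rw [verticalIntegral, ← intervalIntegral.integral_const_mul]
      refine intervalIntegral.integral_congr fun y _ => ?_
      simp only [ofReal_cpow_add_mul_I (div_pos hk' (hpos h hh))]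
      simp only [hb, hl]
      rw [show (I * (Real.log ((k : ℝ) / h) : ℂ) * y : ℂ) = (Real.log ((k : ℝ) / h) * I : ℂ) * y by ring]
      push_cast
      ring
    · intro h _
      apply ContinuousOn.intervalIntegrable
      rw [uIcc_of_le h12]
      exact ContinuousOn.mul (by fun_prop) hζc
  have hmain := hmv S b l N T T₁ T₂ hN' hT (by linarith) h12 h2T (by
    intro m hm n hn
    have key : ∀ m ∈ S, ∀ n ∈ S, m ≤ n → |(m : ℝ) - n| / N ≤ |l m - l n| := by
      intro m hm n hn hmn
      have hm' := hpos m hm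
      have hn' := hpos n hn
      have hnN : (n : ℝ) ≤ N := by exact_mod_cast (Finset.mem_Icc.1 (hS hn)).2
      have hmn' : (m : ℝ) ≤ n := by exact_mod_cast hmn
      have e : l m - l n = Real.log ((n : ℝ) / m) := by
        simp only [hl]
        rw [Real.log_div hk'.ne' hm'.ne', Real.log_div hk'.ne' hn'.ne', Real.log_div hn'.ne' hm'.ne']
        ring
      rw [e]
      refine le_trans ?_ (le_abs_self _)
      have h1 := Real.one_sub_inv_le_log_of_pos (div_pos hn' hm')
      refine le_trans ?_ h1
      rw [inv_div, abs_of_nonpos (by linarith)]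
      calc -((m : ℝ) - n) / N ≤ -((m : ℝ) - n) / n := by
            gcongr; linarith
        _ = 1 - m / n := by field_simp; ring
    rcases le_total m n with h | h
    · exact key m hm n hn h
    · rw [abs_sub_comm, abs_sub_comm (l m)]; exact key n hn m hm h)
  have hbq : ∑ n ∈ S, b n ^ 2 ≤ q ^ 2 * ∑ h ∈ Finset.Icc 1 N, x h ^ 2 := by
    calc ∑ n ∈ S, b n ^ 2 ≤ ∑ n ∈ S, q ^ 2 * x n ^ 2 := by
          refine Finset.sum_le_sum fun h hh => ?_
          simp only [hb]
          rw [mul_pow, mul_comm]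
          have := hq h hh
          have := hpos h hh
          gcongr
      _ ≤ ∑ n ∈ Finset.Icc 1 N, q ^ 2 * x n ^ 2 :=
          Finset.sum_le_sum_of_subset_of_nonneg hS fun _ _ _ => by positivity
      _ = _ := by rw [Finset.mul_sum]
  set X₂ := ∑ h ∈ Finset.Icc 1 N, x h ^ 2 with hX₂
  have hX₂0 : 0 ≤ X₂ := Finset.sum_nonneg fun _ _ => sq_nonneg _
  have hDint : ∫ y in T₁..T₂, ‖D y‖ ≤ Real.sqrt (3 * T * (C₂ * (T + N) * (q ^ 2 * X₂))) := by
    refine intervalIntegral_le_sqrt_mul hDc.norm h12 (by linarith) (hmain.trans ?_)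
    gcongr
  rw [hsum]
  have hb1 : ‖∫ y in T₁..T₂, D y * (riemannZeta ((-δ : ℝ) + y * I))⁻¹‖ ≤
      ∫ y in T₁..T₂, C₁ * (T / 2) ^ (-(1 / 2) : ℝ) * ‖D y‖ := by
    refine intervalIntegral.norm_integral_le_of_norm_le h12 ?_ ?_
    · refine Eventually.of_forall fun y hy => ?_
      rw [norm_mul, mul_comm]
      gcongr
      refine (hζ y (by linarith [hy.1])).trans ?_
      gcongr ?_ * ?_
      exact Real.rpow_le_rpow_of_nonpos (by positivity) (by linarith [hy.1]) (by norm_num)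
    · exact Continuous.intervalIntegrable (by fun_prop) _ _
  refine hb1.trans ?_
  rw [intervalIntegral.integral_const_mul]
  have hTr : (T / 2) ^ (-(1 / 2) : ℝ) = (Real.sqrt (T / 2))⁻¹ := by
    rw [Real.rpow_neg (by positivity), ← Real.sqrt_eq_rpow]
  rw [hTr]
  have hs : Real.sqrt (3 * T * (C₂ * (T + N) * (q ^ 2 * X₂))) =
      Real.sqrt (T / 2) * (Real.sqrt (6 * C₂) * (q * Real.sqrt ((T + N) * X₂))) := by
    rw [show 3 * T * (C₂ * (T + N) * (q ^ 2 * X₂)) = (T / 2) * ((6 * C₂) * (q ^ 2 * ((T + N) * X₂))) by ring,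
      Real.sqrt_mul (by positivity : (0 : ℝ) ≤ T / 2), Real.sqrt_mul (by positivity : (0 : ℝ) ≤ 6 * C₂),
      Real.sqrt_mul (sq_nonneg q),
      Real.sqrt_sq hq0]
  rw [hs] at hDint
  have hsT : 0 < Real.sqrt (T / 2) := Real.sqrt_pos.2 (by positivity)
  calc C₁ * (Real.sqrt (T / 2))⁻¹ * ∫ y in T₁..T₂, ‖D y‖ ≤ C₁ * (Real.sqrt (T / 2))⁻¹ *
        (Real.sqrt (T / 2) * (Real.sqrt (6 * C₂) * (q * Real.sqrt ((T + N) * X₂)))) := by gcongr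
    _ = _ := by field_simp

/-! ### The zero sum for a single pair `(h, k)`. -/

/-- Pairs whose quotient is within a fixed power of the height from `1`. -/
def IsNearPair (T : ℝ) (h k : ℕ) : Prop :=
  T ^ (-48 : ℝ) < (k : ℝ) / h ∧ (k : ℝ) / h < T ^ (48 : ℝ)

theorem abs_diagonalCoeff_le_one (h k : ℕ) : |diagonalCoeff h k| ≤ 1 := by
  unfold diagonalCoeff
  split_ifs
  · exact_mod_cast ArithmeticFunction.abs_moebius_le_one
  · simp

-- For near pairs the left side is left unestimated, because it is small enough only after summation
-- over `h`; for far pairs the narrower rectangle bounds the whole zero sum. In the exponent, `48δ`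
-- comes from `(k/h)^{±δ}` and `δ` from the good heights.
open Classical in
theorem exists_norm_zetaZeroSum_remainder_le (hRH : RiemannHypothesis) (K : ℝ → ℝ) {δ : ℝ}
    (hδ : 0 < δ) (hδ1 : δ ≤ 1 / 2) :
    ∃ C : ℝ, 0 < C ∧ ∀ (T T₁ T₂ : ℝ) (h k : ℕ), 2 ≤ T → 3 ≤ T₁ → T₁ ≤ T₂ → T₂ ≤ 3 * T →
      (∀ s, riemannZeta s = 0 → T₁ ≤ s.im → deriv riemannZeta s ≠ 0) →
      IsGoodHeight K T₁ → IsGoodHeight K T₂ → 0 < h → 0 < k →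
      ‖2 * Real.pi * zetaZeroSum T₁ T₂ ((k : ℝ) / h) - (((T₂ - T₁) * diagonalCoeff h k : ℝ) : ℂ) +
        (if IsNearPair T h k then verticalIntegral T₁ T₂ (-δ) ((k : ℝ) / h) else 0)‖ ≤
      C * T ^ (49 * δ) * (1 + (k : ℝ) / h) + 48 * T ^ δ * offDiagonalSum δ h k := by
  obtain ⟨C₁, hC₁, hfar⟩ := exists_norm_zetaZeroSum_le hRH K hδ (by linarith)
  set S := ∑' n : ℕ, (n : ℝ) ^ (-(1 + δ)) with hS
  have hS0 : 0 ≤ S := tsum_nonneg fun n => by positivity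
  refine ⟨8 * C₁ + 3 + 12 * |K δ| + 4 * S, by positivity, ?_⟩
  intro T T₁ T₂ h k hT h3 h12 h2T hs g1 g2 hh hk
  have hh' : (0 : ℝ) < h := by exact_mod_cast hh
  have hk' : (0 : ℝ) < k := by exact_mod_cast hk
  have hT0 : 0 < T := by linarith
  have hT1 : 1 ≤ T := by linarith
  set r : ℝ := (k : ℝ) / h with hr
  have hr0 : 0 < r := div_pos hk' hh'
  have hoff : 0 ≤ offDiagonalSum δ h k := Finset.sum_nonneg fun _ _ => by positivity
  have hpow : T ^ δ ≤ T ^ (49 * δ) := Real.rpow_le_rpow_of_exponent_le hT1 (by linarith)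
  have hpow1 : 1 ≤ T ^ (49 * δ) := Real.one_le_rpow hT1 (by linarith)
  by_cases hnear : IsNearPair T h k
  · rw [if_pos hnear]
    have main := norm_zetaZeroSum_sub_le hRH (a := -δ) (b := 1 + δ) (by linarith) (by linarith)
      (by linarith) (by linarith) hδ hr0 (by linarith) h12 hs g1 g2
    have right := norm_verticalIntegral_sub_le hδ (by linarith) h12 (by linarith) hT0 hh hk
    rw [← hr, ← hS] at right
    have k1 : K δ * T₁ ^ δ ≤ _ := IsGoodHeight.mul_rpow_le (K := K) hδ (by linarith) (by linarith) hT0.le (by linarith)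
    have k2 : K δ * T₂ ^ δ ≤ _ := IsGoodHeight.mul_rpow_le (K := K) hδ (by linarith) (by linarith) hT0.le h2T
    have r1 : r ^ (-δ) ≤ T ^ (48 * δ) := by
      calc r ^ (-δ) ≤ (T ^ (-48 : ℝ)) ^ (-δ) :=
            Real.rpow_le_rpow_of_nonpos (by positivity) hnear.1.le (by linarith)
        _ = _ := by rw [← Real.rpow_mul hT0.le]; congr 1; ring
    have r2 : r ^ (1 + δ) ≤ T ^ (48 * δ) * r := by
      rw [Real.rpow_add hr0, Real.rpow_one, mul_comm]
      gcongr
      calc r ^ δ ≤ (T ^ (48 : ℝ)) ^ δ := by gcongr; exact hnear.2.le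
        _ = _ := by rw [← Real.rpow_mul hT0.le]
    have hpow48 : T ^ (48 * δ) ≤ T ^ (49 * δ) := Real.rpow_le_rpow_of_exponent_le hT1 (by linarith)
    have e49 : T ^ (48 * δ) * T ^ δ = T ^ (49 * δ) := by rw [← Real.rpow_add hT0]; congr 1; ring
    have b1 : (r ^ (-δ) + r ^ (1 + δ)) * (K δ * T₁ ^ δ + K δ * T₂ ^ δ) * (1 + δ - -δ) ≤
        12 * |K δ| * T ^ (49 * δ) * (1 + r) := by
      calc _ ≤ (T ^ (48 * δ) + T ^ (48 * δ) * r) * (3 * |K δ| * T ^ δ + 3 * |K δ| * T ^ δ) * 2 := by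
            have := add_nonneg (g1.mul_rpow_nonneg hδ) (g2.mul_rpow_nonneg hδ)
            gcongr <;> linarith
        _ = 12 * |K δ| * (T ^ (48 * δ) * T ^ δ) * (1 + r) := by ring
        _ = _ := by rw [e49]
    have b2 : 4 * r ^ (1 + δ) * S ≤ 4 * S * T ^ (49 * δ) * (1 + r) := by
      calc _ ≤ 4 * (T ^ (49 * δ) * (1 + r)) * S := by
            gcongr
            refine r2.trans ?_
            gcongr; linarith
        _ = _ := by ring
    have e : 2 * Real.pi * zetaZeroSum T₁ T₂ r - (((T₂ - T₁) * diagonalCoeff h k : ℝ) : ℂ) +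
        verticalIntegral T₁ T₂ (-δ) r = (2 * Real.pi * zetaZeroSum T₁ T₂ r -
          (verticalIntegral T₁ T₂ (1 + δ) r - verticalIntegral T₁ T₂ (-δ) r)) +
        (verticalIntegral T₁ T₂ (1 + δ) r - (((T₂ - T₁) * diagonalCoeff h k : ℝ) : ℂ)) := by ring
    rw [e]
    refine (norm_add_le _ _).trans ?_
    have hrest : 0 ≤ (8 * C₁ + 3) * T ^ (49 * δ) * (1 + r) := by positivity
    calc _ ≤ 12 * |K δ| * T ^ (49 * δ) * (1 + r) +
          (4 * S * T ^ (49 * δ) * (1 + r) + 48 * T ^ δ * offDiagonalSum δ h k) := by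
          refine add_le_add (main.trans b1) (right.trans ?_)
          linarith
      _ ≤ _ := by linarith
  · rw [if_neg hnear, add_zero]
    have hcase : T ^ (48 : ℝ) ≤ r ∨ r ≤ T ^ (-48 : ℝ) := by
      unfold IsNearPair at hnear
      rw [← hr] at hnear
      by_contra hcon
      push Not at hcon
      exact hnear ⟨hcon.2, hcon.1⟩
    have b1 := hfar T T₁ T₂ r hT1 h3 h12 h2T hs g1 g2 hr0 hcase
    have b2 : ‖(((T₂ - T₁) * diagonalCoeff h k : ℝ) : ℂ)‖ ≤ 3 * T ^ (49 * δ) * (1 + r) := by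
      rw [Complex.norm_real, Real.norm_eq_abs, abs_mul, abs_of_nonneg (by linarith)]
      -- A far pair with `h ∣ k` has `r ≥ T^{48} ≥ T`, so even its diagonal term, of size at most
      -- `3T`, is absorbed by `1 + r`.
      by_cases hd : h ∣ k
      · have hr1 : 1 ≤ r := by
          rw [hr, one_le_div hh']
          exact_mod_cast Nat.le_of_dvd hk hd
        have hTr : T ≤ r := by
          rcases hcase with hc | hc
          · refine le_trans ?_ hc
            calc T = T ^ (1 : ℝ) := (Real.rpow_one T).symm
              _ ≤ _ := Real.rpow_le_rpow_of_exponent_le hT1 (by norm_num)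
          · have := Real.rpow_lt_one_of_one_lt_of_neg (show 1 < T by linarith) (show (-48 : ℝ) < 0 by norm_num)
            linarith
        calc (T₂ - T₁) * |diagonalCoeff h k| ≤ (3 * r) * 1 := by
              gcongr
              · linarith
              · exact abs_diagonalCoeff_le_one h k
          _ ≤ 3 * 1 * (1 + r) := by linarith
          _ ≤ _ := by gcongr
      · rw [diagonalCoeff, if_neg hd, abs_zero, mul_zero]
        positivity
    refine (norm_sub_le _ _).trans ?_
    have e2 : ‖2 * Real.pi * zetaZeroSum T₁ T₂ r‖ ≤ 8 * C₁ * T ^ (49 * δ) * (1 + r) := by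
      rw [norm_mul, norm_mul, Complex.norm_real, Real.norm_of_nonneg Real.pi_pos.le]
      simp only [norm_ofNat]
      calc 2 * Real.pi * ‖zetaZeroSum T₁ T₂ r‖ ≤ 2 * 4 * (C₁ * T ^ (49 * δ) * (1 + r)) := by
            gcongr
            · exact Real.pi_le_four
            · exact b1.trans (by gcongr)
        _ = _ := by ring
    have h1 : 0 ≤ (12 * |K δ| + 4 * S) * T ^ (49 * δ) * (1 + r) := by positivity
    have h2 : 0 ≤ 48 * T ^ δ * offDiagonalSum δ h k := by positivity
    linarith

/-! ### Expansion of the moment and final assembly. -/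

/-- On the critical line `conj (-ρ) = ρ - 1`, so the conjugate becomes analytic in `ρ`. -/
theorem natCast_cpow_neg_mul_conj {ρ : ℂ} (hρ : ρ.re = 1 / 2) {h k : ℕ} (hk : 0 < k) :
    (h : ℂ) ^ (-ρ) * (starRingEnd ℂ) ((k : ℂ) ^ (-ρ)) = (((k : ℝ) / h : ℝ) : ℂ) ^ ρ / k := by
  have hk' : (k : ℂ) ≠ 0 := by exact_mod_cast hk.ne'
  have h1 : (starRingEnd ℂ) ((k : ℂ) ^ (-ρ)) = (k : ℂ) ^ (ρ - 1) := by
    have e : (starRingEnd ℂ) (-ρ) = ρ - 1 := by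
      apply Complex.ext <;> simp [hρ]
      norm_num
    rw [← e, cpow_conj _ _ (by rw [natCast_arg]; exact Real.pi_pos.ne), conj_natCast]
  have h2 := div_cpow_ofReal_nonneg (Nat.cast_nonneg (α := ℝ) k) (Nat.cast_nonneg (α := ℝ) h) ρ
  rw [ofReal_natCast, ofReal_natCast] at h2
  rw [h1, ofReal_div, ofReal_natCast, ofReal_natCast, h2, cpow_neg, cpow_sub _ _ hk', cpow_one]
  ring

theorem zetaZeroMoment_eq (hRH : RiemannHypothesis) (x : ℕ → ℝ) (M : ℝ) {T₁ T₂ : ℝ} (hT₁ : 0 < T₁) :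
    zetaZeroMoment x M T₁ T₂ = ∑ k ∈ Finset.Icc 1 ⌊M⌋₊, ∑ h ∈ Finset.Icc 1 ⌊M⌋₊,
      ((x k / k * x h : ℝ) : ℂ) * zetaZeroSum T₁ T₂ ((k : ℝ) / h) := by
  unfold zetaZeroMoment zetaZeroSum
  simp only [Finset.mul_sum]
  rw [Finset.sum_congr rfl fun k _ => Finset.sum_comm, Finset.sum_comm]
  refine Finset.sum_congr rfl fun ρ hρ => ?_
  rw [Set.Finite.mem_toFinset] at hρ
  have hre := re_eq_half_of_riemannZeta_eq_zero hRH hρ.1 (by linarith [hρ.2.2.1])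
  have e : ((‖dirichletPoly x M ρ‖ ^ 2 : ℝ) : ℂ) =
      (starRingEnd ℂ) (dirichletPoly x M ρ) * dirichletPoly x M ρ := by
    rw [mul_comm, Complex.mul_conj, Complex.normSq_eq_norm_sq]
  rw [e, dirichletPoly, map_sum, Finset.sum_mul_sum, Finset.mul_sum]
  refine Finset.sum_congr rfl fun k hk => ?_
  rw [Finset.mul_sum]
  refine Finset.sum_congr rfl fun h _ => ?_
  have := natCast_cpow_neg_mul_conj hre (h := h) (Finset.mem_Icc.1 hk).1
  rw [map_mul, conj_ofReal, show (deriv riemannZeta ρ)⁻¹ * ((x k : ℂ) * (starRingEnd ℂ) ((k : ℂ) ^ (-ρ)) *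
    ((x h : ℂ) * (h : ℂ) ^ (-ρ))) = (deriv riemannZeta ρ)⁻¹ * (x k * x h : ℂ) *
      ((h : ℂ) ^ (-ρ) * (starRingEnd ℂ) ((k : ℂ) ^ (-ρ))) by ring, this]
  push_cast
  ring

theorem moebiusQuadraticForm_eq (x : ℕ → ℝ) {M : ℝ} (hM : 0 ≤ M) :
    moebiusQuadraticForm x M = ∑ k ∈ Finset.Icc 1 ⌊M⌋₊, ∑ h ∈ Finset.Icc 1 ⌊M⌋₊,
      x k / k * x h * diagonalCoeff h k := by
  unfold moebiusQuadraticForm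
  have e : ∑ k ∈ Finset.Icc 1 ⌊M⌋₊, ∑ h ∈ Finset.Icc 1 ⌊M⌋₊, x k / k * x h * diagonalCoeff h k =
      ∑ p ∈ Finset.Icc 1 ⌊M⌋₊ ×ˢ Finset.Icc 1 ⌊M⌋₊ with p.1 ∣ p.2,
        x p.2 / p.2 * x p.1 * (ArithmeticFunction.moebius (p.2 / p.1) : ℝ) := by
    rw [Finset.sum_comm, ← Finset.sum_product', Finset.sum_filter]
    refine Finset.sum_congr rfl fun p _ => ?_
    unfold diagonalCoeff
    split_ifs <;> simp
  rw [e]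
  refine Finset.sum_bij' (fun p _ => (p.1, p.2 * p.1)) (fun p _ => (p.1, p.2 / p.1)) ?_ ?_ ?_ ?_ ?_
  · rintro ⟨h, n⟩ hp
    simp only [Finset.mem_filter, Finset.mem_product, Finset.mem_Icc] at hp ⊢
    have h1 := (Nat.le_floor_iff hM).2 hp.2
    refine ⟨⟨hp.1.1, Nat.mul_pos (by omega) (by omega), by rwa [mul_comm]⟩, Dvd.intro_left _ rfl⟩
  · rintro ⟨h, k⟩ hp
    simp only [Finset.mem_filter, Finset.mem_product, Finset.mem_Icc] at hp ⊢
    obtain ⟨⟨⟨h1, h2⟩, h3, h4⟩, n, rfl⟩ := hp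
    have hn : 0 < n := by
      rcases Nat.eq_zero_or_pos n with rfl | hn
      · simp at h3
      · exact hn
    rw [Nat.mul_div_cancel_left _ (by omega)]
    refine ⟨⟨⟨h1, h2⟩, hn, le_trans ?_ h4⟩, (Nat.le_floor_iff hM).1 h4⟩
    exact Nat.le_mul_of_pos_left n (by omega)
  · rintro ⟨h, n⟩ hp
    simp only [Finset.mem_filter, Finset.mem_product, Finset.mem_Icc] at hp ⊢
    rw [Nat.mul_div_cancel _ (by omega)]
  · rintro ⟨h, k⟩ hp
    simp only [Finset.mem_filter, Finset.mem_product, Finset.mem_Icc] at hp ⊢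
    rw [Nat.div_mul_cancel hp.2]
  · rintro ⟨h, n⟩ hp
    simp only [Finset.mem_filter, Finset.mem_product, Finset.mem_Icc] at hp ⊢
    rw [Nat.mul_div_cancel _ (by omega)]
    ring

theorem abs_le_seqNormSup (x : ℕ → ℝ) {M : ℝ} {n : ℕ} (hn : n ∈ Finset.Icc 1 ⌊M⌋₊) :
    |x n| ≤ seqNormSup x M := by
  unfold seqNormSup
  have := Finset.le_sup (f := fun n => ‖x n‖₊) hn
  rw [← Real.norm_eq_abs, ← coe_nnnorm]
  exact_mod_cast this

theorem seqNormOne_nonneg (x : ℕ → ℝ) (M : ℝ) : 0 ≤ seqNormOne x M :=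
  Finset.sum_nonneg fun _ _ => abs_nonneg _

/-- The weight `(1 + k/h)/k = 1/k + 1/h` is symmetric, and each half factors. -/
theorem sum_sum_abs_mul_one_add_div (x : ℕ → ℝ) (M : ℝ) :
    ∑ k ∈ Finset.Icc 1 ⌊M⌋₊, ∑ h ∈ Finset.Icc 1 ⌊M⌋₊, |x k / k * x h| * (1 + (k : ℝ) / h) =
      2 * (seqNormOne (fun n => x n / n) M * seqNormOne x M) := by
  have e : ∀ k ∈ Finset.Icc 1 ⌊M⌋₊, ∀ h ∈ Finset.Icc 1 ⌊M⌋₊,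
      |x k / k * x h| * (1 + (k : ℝ) / h) = |x k / k| * |x h| + |x k| * |x h / h| := by
    intro k hk h hh
    have hk' : (0 : ℝ) < k := by exact_mod_cast (Finset.mem_Icc.1 hk).1
    have hh' : (0 : ℝ) < h := by exact_mod_cast (Finset.mem_Icc.1 hh).1
    rw [abs_mul, abs_div, abs_div, abs_of_pos hk', abs_of_pos hh']
    field_simp
  rw [Finset.sum_congr rfl fun k hk => Finset.sum_congr rfl (e k hk)]
  simp only [Finset.sum_add_distrib]
  rw [← Finset.sum_mul_sum, ← Finset.sum_mul_sum]
  unfold seqNormOne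
  ring

/-- Only `x_k` is replaced by its maximum; the sum over `k` then returns `M/h`, and `|x_h|/h` is
left to be summed. -/
theorem sum_sum_abs_mul_offDiagonalSum_le {δ : ℝ} (hδ : 0 < δ) (hδ1 : δ < 1) (x : ℕ → ℝ) {M : ℝ}
    (hM : 0 ≤ M) :
    ∑ k ∈ Finset.Icc 1 ⌊M⌋₊, ∑ h ∈ Finset.Icc 1 ⌊M⌋₊, |x k / k * x h| * offDiagonalSum δ h k ≤
      8 / (δ * (1 - δ)) * (seqNormOne (fun n => x n / n) M * (M * seqNormSup x M)) := by
  have h1δ : 0 < 1 - δ := by linarith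
  have hsup : 0 ≤ seqNormSup x M := NNReal.coe_nonneg _
  rw [Finset.sum_comm]
  have e : ∀ h ∈ Finset.Icc 1 ⌊M⌋₊, ∑ k ∈ Finset.Icc 1 ⌊M⌋₊, |x k / k * x h| * offDiagonalSum δ h k ≤
      |x h / h| * (8 / (δ * (1 - δ)) * (M * seqNormSup x M)) := by
    intro h hh
    have hh' : (0 : ℝ) < h := by exact_mod_cast (Finset.mem_Icc.1 hh).1
    calc _ ≤ ∑ k ∈ Finset.Icc 1 ⌊M⌋₊, |x h| * seqNormSup x M * (offDiagonalSum δ h k / k) := by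
          refine Finset.sum_le_sum fun k hk => ?_
          have hk' : (0 : ℝ) < k := by exact_mod_cast (Finset.mem_Icc.1 hk).1
          have hoff : 0 ≤ offDiagonalSum δ h k := Finset.sum_nonneg fun _ _ => by positivity
          rw [abs_mul, abs_div, abs_of_pos hk']
          calc |x k| / k * |x h| * offDiagonalSum δ h k = |x h| * |x k| * (offDiagonalSum δ h k / k) := by ring
            _ ≤ _ := by gcongr; exact abs_le_seqNormSup x hk
      _ = |x h| * seqNormSup x M * ∑ k ∈ Finset.Icc 1 ⌊M⌋₊, offDiagonalSum δ h k / k := by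
          rw [Finset.mul_sum]
      _ ≤ |x h| * seqNormSup x M * (8 / (δ * (1 - δ)) * (M / h)) := by
          gcongr
          refine (sum_offDiagonalSum_div_le hδ hδ1 (Finset.mem_Icc.1 hh).1).trans ?_
          gcongr
          exact Nat.floor_le hM
      _ = _ := by rw [abs_div, abs_of_pos hh']; ring
  refine (Finset.sum_le_sum e).trans (le_of_eq ?_)
  rw [← Finset.sum_mul]
  unfold seqNormOne
  ring

/-- Subadditivity of the square root, with `‖x_n²‖₁ ≤ M ‖x_n‖_∞²` in the term not containing `T`. -/
theorem sqrt_add_mul_seqNormOne_sq_le (x : ℕ → ℝ) {M T : ℝ} (hM : 0 ≤ M) (hT : 0 ≤ T) :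
    Real.sqrt ((T + ⌊M⌋₊) * ∑ h ∈ Finset.Icc 1 ⌊M⌋₊, x h ^ 2) ≤
      T ^ (1 / 2 : ℝ) * (seqNormOne (fun n => x n ^ 2) M) ^ (1 / 2 : ℝ) + M * seqNormSup x M := by
  have hsup : 0 ≤ seqNormSup x M := NNReal.coe_nonneg _
  have e : ∑ h ∈ Finset.Icc 1 ⌊M⌋₊, x h ^ 2 = seqNormOne (fun n => x n ^ 2) M :=
    Finset.sum_congr rfl fun h _ => (abs_of_nonneg (sq_nonneg _)).symm
  have hb : seqNormOne (fun n => x n ^ 2) M ≤ M * seqNormSup x M ^ 2 := by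
    rw [← e]
    refine (Finset.sum_le_card_nsmul _ _ (seqNormSup x M ^ 2) fun h hh => ?_).trans ?_
    · rw [← sq_abs]; gcongr; exact abs_le_seqNormSup x hh
    · rw [Nat.card_Icc, Nat.add_sub_cancel, nsmul_eq_mul]
      gcongr; exact Nat.floor_le hM
  have h0 := seqNormOne_nonneg (fun n => x n ^ 2) M
  rw [e, ← Real.sqrt_eq_rpow, ← Real.sqrt_eq_rpow, ← Real.sqrt_mul hT]
  refine Real.sqrt_le_iff.2 ⟨by positivity, ?_⟩
  have h1 : (⌊M⌋₊ : ℝ) * seqNormOne (fun n => x n ^ 2) M ≤ (M * seqNormSup x M) ^ 2 := by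
    calc _ ≤ M * (M * seqNormSup x M ^ 2) := by gcongr; exact Nat.floor_le hM
      _ = _ := by ring
  have h2 := Real.sq_sqrt (mul_nonneg hT h0)
  have h3 : 0 ≤ Real.sqrt (T * seqNormOne (fun n => x n ^ 2) M) * (M * seqNormSup x M) := by positivity
  nlinarith

open Classical in
theorem exists_norm_zetaZeroMoment_sub_le (hRH : RiemannHypothesis) (K : ℝ → ℝ) {δ : ℝ}
    (hδ : 0 < δ) (hδ1 : δ ≤ 1 / 2) :
    ∃ C : ℝ, 0 < C ∧ ∀ (T T₁ T₂ M : ℝ) (x : ℕ → ℝ), 2 ≤ T → 3 ≤ T₁ → T ≤ 2 * T₁ → T₁ ≤ T₂ →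
      T₂ ≤ 3 * T → (∀ s, riemannZeta s = 0 → T₁ ≤ s.im → deriv riemannZeta s ≠ 0) →
      IsGoodHeight K T₁ → IsGoodHeight K T₂ → 1 ≤ M →
      ‖zetaZeroMoment x M T₁ T₂ -
          (((T₂ - T₁) / (2 * Real.pi) * moebiusQuadraticForm x M : ℝ) : ℂ)‖ ≤
        C * T ^ (49 * δ) * seqNormOne (fun n => x n / n) M * (M * seqNormSup x M + seqNormOne x M +
          T ^ (1 / 2 : ℝ) * (seqNormOne (fun n => x n ^ 2) M) ^ (1 / 2 : ℝ)) := by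
  obtain ⟨C₁, hC₁, hrem⟩ := exists_norm_zetaZeroSum_remainder_le hRH K hδ hδ1
  obtain ⟨C₂, hC₂, hleft⟩ := exists_norm_sum_verticalIntegral_le hRH hδ
  have h1δ : 0 < 1 - δ := by linarith
  refine ⟨2 * C₁ + 48 * (8 / (δ * (1 - δ))) + C₂, by positivity, ?_⟩
  intro T T₁ T₂ M x hT h3 hTT h12 h2T hs g1 g2 hM
  have hT0 : 0 < T := by linarith
  have hT1 : 1 ≤ T := by linarith
  have hM0 : 0 ≤ M := by linarith
  set I := Finset.Icc 1 ⌊M⌋₊ with hI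
  have hNpos : 0 < ⌊M⌋₊ := Nat.floor_pos.2 hM
  set a : ℕ → ℕ → ℝ := fun k h => x k / k * x h with ha
  set V : ℕ → ℕ → ℂ := fun k h =>
    if IsNearPair T h k then verticalIntegral T₁ T₂ (-δ) ((k : ℝ) / h) else 0 with hV
  set R : ℕ → ℕ → ℂ := fun k h => 2 * Real.pi * zetaZeroSum T₁ T₂ ((k : ℝ) / h) -
    (((T₂ - T₁) * diagonalCoeff h k : ℝ) : ℂ) + V k h with hR
  have hπ : (2 * Real.pi : ℂ) ≠ 0 := by
    exact_mod_cast (by positivity : (2 * Real.pi : ℝ) ≠ 0)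
  have hid : 2 * Real.pi * (zetaZeroMoment x M T₁ T₂ -
      (((T₂ - T₁) / (2 * Real.pi) * moebiusQuadraticForm x M : ℝ) : ℂ)) =
      ∑ k ∈ I, ∑ h ∈ I, (a k h : ℂ) * R k h - ∑ k ∈ I, ∑ h ∈ I, (a k h : ℂ) * V k h := by
    have e1 : 2 * Real.pi * (((T₂ - T₁) / (2 * Real.pi) * moebiusQuadraticForm x M : ℝ) : ℂ) =
        (((T₂ - T₁) * moebiusQuadraticForm x M : ℝ) : ℂ) := by
      push_cast; field_simp
    rw [mul_sub, e1, zetaZeroMoment_eq hRH x M (by linarith), moebiusQuadraticForm_eq x hM0]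
    push_cast
    simp only [Finset.mul_sum, ← Finset.sum_sub_distrib]
    refine Finset.sum_congr rfl fun k _ => Finset.sum_congr rfl fun h _ => ?_
    simp only [hR, ha]
    push_cast
    ring
  have hXn := seqNormOne_nonneg (fun n => x n / n) M
  have hX1 := seqNormOne_nonneg x M
  have hX2 := seqNormOne_nonneg (fun n => x n ^ 2) M
  have hsup : 0 ≤ seqNormSup x M := NNReal.coe_nonneg _
  set Xn := seqNormOne (fun n => x n / n) M with hXn'
  have hp : T ^ δ ≤ T ^ (49 * δ) := Real.rpow_le_rpow_of_exponent_le hT1 (by linarith)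
  have hp48 : T ^ (48 * δ) ≤ T ^ (49 * δ) := Real.rpow_le_rpow_of_exponent_le hT1 (by linarith)
  have bR : ‖∑ k ∈ I, ∑ h ∈ I, (a k h : ℂ) * R k h‖ ≤ C₁ * T ^ (49 * δ) * (2 * (Xn * seqNormOne x M)) +
      48 * T ^ (49 * δ) * (8 / (δ * (1 - δ)) * (Xn * (M * seqNormSup x M))) := by
    calc _ ≤ ∑ k ∈ I, ∑ h ∈ I, (C₁ * T ^ (49 * δ) * (|x k / k * x h| * (1 + (k : ℝ) / h)) +
          48 * T ^ (49 * δ) * (|x k / k * x h| * offDiagonalSum δ h k)) := by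
          refine (norm_sum_le _ _).trans (Finset.sum_le_sum fun k hk => (norm_sum_le _ _).trans
            (Finset.sum_le_sum fun h hh => ?_))
          have b := hrem T T₁ T₂ h k hT h3 h12 h2T hs g1 g2 (Finset.mem_Icc.1 hh).1 (Finset.mem_Icc.1 hk).1
          have hoff : 0 ≤ offDiagonalSum δ h k := Finset.sum_nonneg fun _ _ => by positivity
          rw [norm_mul, Complex.norm_real, Real.norm_eq_abs]
          calc |a k h| * ‖R k h‖ ≤ |x k / k * x h| * (C₁ * T ^ (49 * δ) * (1 + (k : ℝ) / h) +
                48 * T ^ (49 * δ) * offDiagonalSum δ h k) := by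
                simp only [ha]
                gcongr
                exact b.trans (by gcongr)
            _ = _ := by ring
      _ = C₁ * T ^ (49 * δ) * (∑ k ∈ I, ∑ h ∈ I, |x k / k * x h| * (1 + (k : ℝ) / h)) +
          48 * T ^ (49 * δ) * (∑ k ∈ I, ∑ h ∈ I, |x k / k * x h| * offDiagonalSum δ h k) := by
          simp only [Finset.sum_add_distrib, Finset.mul_sum]
      _ ≤ _ := by
          rw [sum_sum_abs_mul_one_add_div]
          gcongr
          exact sum_sum_abs_mul_offDiagonalSum_le hδ (by linarith) x hM0
  have bV : ‖∑ k ∈ I, ∑ h ∈ I, (a k h : ℂ) * V k h‖ ≤ Xn * (C₂ * T ^ (49 * δ) *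
      (T ^ (1 / 2 : ℝ) * (seqNormOne (fun n => x n ^ 2) M) ^ (1 / 2 : ℝ) + M * seqNormSup x M)) := by
    rw [hXn', seqNormOne, Finset.sum_mul]
    refine (norm_sum_le _ _).trans (Finset.sum_le_sum fun k hk => ?_)
    -- For fixed `k` the near pairs form a set of `h`, so the mean value estimate applies for each
    -- `k`; the sum over `k` costs `‖x_n/n‖₁`.
    have e : ∑ h ∈ I, (a k h : ℂ) * V k h = ((x k / k : ℝ) : ℂ) *
        ∑ h ∈ I with IsNearPair T h k, (x h : ℂ) * verticalIntegral T₁ T₂ (-δ) ((k : ℝ) / h) := by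
      rw [Finset.sum_filter, Finset.mul_sum]
      refine Finset.sum_congr rfl fun h _ => ?_
      simp only [ha, hV]
      split_ifs
      · push_cast; ring
      · simp
    rw [e, norm_mul, Complex.norm_real, Real.norm_eq_abs]
    gcongr
    refine (hleft _ x ⌊M⌋₊ k T T₁ T₂ (T ^ (48 * δ)) hNpos (Finset.mem_Icc.1 hk).1
      (Finset.filter_subset _ _) (by linarith) hTT h12 h2T (by positivity) ?_).trans ?_
    · intro h hh
      have hnear := (Finset.mem_filter.1 hh).2
      calc ((k : ℝ) / h) ^ (-δ) ≤ (T ^ (-48 : ℝ)) ^ (-δ) :=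
            Real.rpow_le_rpow_of_nonpos (by positivity) hnear.1.le (by linarith)
        _ = _ := by rw [← Real.rpow_mul hT0.le]; congr 1; ring
    · gcongr
      exact sqrt_add_mul_seqNormOne_sq_le x hM0 hT0.le
  set D := zetaZeroMoment x M T₁ T₂ - (((T₂ - T₁) / (2 * Real.pi) * moebiusQuadraticForm x M : ℝ) : ℂ)
  have hD : ‖D‖ ≤ ‖2 * Real.pi * D‖ := by
    rw [norm_mul]
    apply le_mul_of_one_le_left (norm_nonneg _)
    rw [norm_mul, Complex.norm_real, Real.norm_of_nonneg Real.pi_pos.le]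
    simp only [norm_ofNat]
    linarith [Real.pi_gt_three]
  refine hD.trans ?_
  rw [hid]
  refine (norm_sub_le _ _).trans ((add_le_add bR bV).trans ?_)
  set W := T ^ (1 / 2 : ℝ) * (seqNormOne (fun n => x n ^ 2) M) ^ (1 / 2 : ℝ) with hW
  have hW0 : 0 ≤ W := by positivity
  have hMs : 0 ≤ M * seqNormSup x M := by positivity
  set P := T ^ (49 * δ)
  have hP0 : 0 ≤ P * Xn := by positivity
  set G := 8 / (δ * (1 - δ))
  have hG : 0 ≤ G := by positivity
  have t1 : 0 ≤ P * Xn * (2 * C₁ * (M * seqNormSup x M + W)) := by positivity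
  have t2 : 0 ≤ P * Xn * (48 * G * (seqNormOne x M + W)) := by positivity
  have t3 : 0 ≤ P * Xn * (C₂ * seqNormOne x M) := by positivity
  linarith

theorem proposition2
    (hRH : RiemannHypothesis)
    (hsimple : {ρ : ℂ | riemannZeta ρ = 0 ∧ deriv riemannZeta ρ = 0}.Finite)
    (B : ℝ) (K : ℝ → ℝ) (ε : ℝ) (hε : 0 < ε) :
    ∃ C T₀ : ℝ, ∀ (T T₁ T₂ M : ℝ) (x : ℕ → ℝ),
      T₀ ≤ T →
      |T₁ - T| ≤ B → |T₂ - 2 * T| ≤ B →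
      IsGoodHeight K T₁ → IsGoodHeight K T₂ →
      1 ≤ M →
      (∀ δ : ℝ, 0 < δ → seqNormOne (fun n => x n / n) M ≤ K δ * T ^ δ) →
      ‖zetaZeroMoment x M T₁ T₂ -
          (((T₂ - T₁) / (2 * Real.pi) * moebiusQuadraticForm x M : ℝ) : ℂ)‖ ≤
        C * (T ^ ε * (M * seqNormSup x M + seqNormOne x M +
          T ^ (1 / 2 : ℝ) * (seqNormOne (fun n => x n ^ 2) M) ^ (1 / 2 : ℝ))) := by
  -- Here `50 = 49 + 1`: the last `T^δ` is the bound assumed for `‖x_n/n‖₁`.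
  set δ := min (ε / 50) (1 / 2) with hδ
  have hδ0 : 0 < δ := by positivity
  have hδε : δ ≤ ε / 50 := min_le_left _ _
  obtain ⟨C, hC, hmain⟩ := exists_norm_zetaZeroMoment_sub_le hRH K hδ0 (min_le_right _ _)
  obtain ⟨Y, hY⟩ := (hsimple.image Complex.im).bddAbove
  -- The first threshold gives `T₁ ≥ T/2 + 3` and `T₁ ≤ T₂ ≤ 3T`; the second puts `T₁` above `Y`,
  -- hence above every multiple zero.
  refine ⟨C * |K δ|, max (2 * |B| + 6) (2 * Y + 2), ?_⟩
  intro T T₁ T₂ M x hT₀ h1 h2 g1 g2 hM hx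
  have hTB : 2 * |B| + 6 ≤ T := (le_max_left _ _).trans hT₀
  have hTY : 2 * Y + 2 ≤ T := (le_max_right _ _).trans hT₀
  have hB := le_abs_self B
  have hB0 := abs_nonneg B
  rw [abs_le] at h1 h2
  have hT1 : 1 ≤ T := by linarith
  have hs : ∀ s, riemannZeta s = 0 → T₁ ≤ s.im → deriv riemannZeta s ≠ 0 := by
    intro s hs him hd
    have : s.im ≤ Y := hY ⟨s, ⟨hs, hd⟩, rfl⟩
    linarith [h1.1]
  refine (hmain T T₁ T₂ M x (by linarith) (by linarith) (by linarith) (by linarith) (by linarith)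
    hs g1 g2 hM).trans ?_
  have hX1 := seqNormOne_nonneg x M
  have hX2 := seqNormOne_nonneg (fun n => x n ^ 2) M
  have hsup : 0 ≤ seqNormSup x M := NNReal.coe_nonneg _
  set W := M * seqNormSup x M + seqNormOne x M +
    T ^ (1 / 2 : ℝ) * (seqNormOne (fun n => x n ^ 2) M) ^ (1 / 2 : ℝ)
  have hW : 0 ≤ W := by positivity
  calc _ ≤ C * T ^ (49 * δ) * (|K δ| * T ^ δ) * W := by
        gcongr
        refine (hx δ hδ0).trans ?_
        gcongr
        exact le_abs_self _
    _ = C * |K δ| * (T ^ (49 * δ) * T ^ δ * W) := by ring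
    _ = C * |K δ| * (T ^ (50 * δ) * W) := by
        rw [← Real.rpow_add (by linarith : 0 < T)]; congr 3; ring_nf
    _ ≤ _ := by
        gcongr
        linarith
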